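/- Let $d\in\mathbb{N}$, $1<p<\infty$, let $v_1,\dots,v_d\in\mathbb{R}^d$ be linearly independent, $A=(v_1,\dots,v_d)$ and $\mathcal{L}=A\mathbb{Z}^d$. For $\varepsilon>0$ let $\mathcal{L}_\varepsilon=\varepsilon\mathcal{L}$, let $\mathcal{L}'_\varepsilon=\mathcal{L}_\varepsilon+\varepsilon A(\tfrac12,\dots,\tfrac12)$ be the set of centers of the cells $z+A[0,\varepsilon)^d$, $z\in\mathcal{L}_\varepsilon$, let $Q_\varepsilon(x)$ be the cell containing $x$ and $\bar x$ its center, and let $z_1,\dots,z_{2^d}$ be the points of $A\{-\tfrac12,\tfrac12\}^d$. For $U\subset\mathbb{R}^d$ bounded and open put $$\mathcal{L}'_\varepsilon(U)=\{x\in\mathcal{L}'_\varepsilon:\overline{Q_\varepsilon(x)}\cap U\neq\emptyset\},\quad (\mathcal{L}'_\varepsilon(U))^\circ=\{x\in\mathcal{L}'_\varepsilon:\overline{Q_\varepsilon(x)}\subset U\},$$ $$\partial\mathcal{L}_\varepsilon(U)=\big(\mathcal{L}'_\varepsilon(U)\setminus(\mathcal{L}'_\varepsilon(U))^\circ\big)+\varepsilon\{z_1,\dots,z_{2^d}\}.$$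 Let $\mathcal{B}_\varepsilon(U)$ be the set of functions $y:U\to\mathbb{R}^d$ that are constant on $Q_\varepsilon(x)\cap U$ for every $x\in\mathcal{L}'_\varepsilon(U)$, and extend such $y$ to be constant on each cell $Q_\varepsilon(x)$ with $x\in\mathcal{L}'_\varepsilon(U)$. For $x\in(\mathcal{L}'_\varepsilon(U))^\circ$ let $$\bar y(x)=\frac1{2^d}\sum_{i=1}^{2^d}y(x+\varepsilon z_i),\qquad \bar\nabla y(x)=\frac1\varepsilon\big(y(x+\varepsilon z_1)-\bar y(x),\dots,y(x+\varepsilon z_{2^d})-\bar y(x)\big)\in\mathbb{R}^{d\times 2^d}.$$ Let $W_{\rm cell}:\mathbb{R}^{d\times2^d}\to[0,\infty)$ be such that, for some $c,c',c''>0$, $$c|F|^p-c'\le W_{\rm cell}(F)\le c''(|F|^p+1)$$ for all $F\in\mathbb{R}^{d\times 2^d}$ whose columns sum to $0$. Let $\Omega\subset\mathbb{R}^d$ be bounded and open with Lipschitz boundary, let $g\in W^{1,\infty}(\mathbb{R}^d;\mathbb{R}^d)$ be continuous, and let $\mathcal{B}_\varepsilon(\Omega,g)$ be the set of those $y\in\mathcal{B}_\varepsilon(\Omega)$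 with $y(x)=g(\bar x)$ for every $x\in\partial\mathcal{L}_\varepsilon(\Omega)$ at which the extension of $y$ is defined. For $y\in L^p(\Omega;\mathbb{R}^d)$ set $$F^g_\varepsilon(y,\Omega)=\varepsilon^d\sum_{x\in(\mathcal{L}'_\varepsilon(\Omega))^\circ}W_{\rm cell}(\bar\nabla y(x))\ \text{ if }y\in\mathcal{B}_\varepsilon(\Omega,g),\qquad F^g_\varepsilon(y,\Omega)=\infty\ \text{ otherwise.}$$ **Theorem (Compactness).** Let $\varepsilon_n>0$ with $\varepsilon_n\to0$ and let $y_n\in L^p(\Omega;\mathbb{R}^d)$ satisfy $\sup_n F^g_{\varepsilon_n}(y_n,\Omega)<\infty$. Then there exist a subsequence $(n_k)$ and $y\in W^{1,p}(\Omega;\mathbb{R}^d)$ with $y=g$ on $\partial\Omega$, i.e. $y\in g+W^{1,p}_0(\Omega;\mathbb{R}^d)$, such that $y_{n_k}\to y$ strongly in $L^p(\Omega;\mathbb{R}^d)$. -/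

import Mathlib

open MeasureTheory Filter Topology
open scoped ENNReal NNReal ContDiff

namespace Atomistic

/-- Euclidean space `ℝ^d`. -/
abbrev Space (d : ℕ) : Type := EuclideanSpace ℝ (Fin d)

/-! ### Sobolev spaces and Lipschitz domains -/

/-- `Du` is a weak gradient of `u : Ω → ℝ^d`: for all real test functions `φ ∈ C_c^∞(Ω)` and all
directions `w`, `∫_Ω (∂_w φ) u = - ∫_Ω φ (Du) w`. -/
def HasWeakGradient {d : ℕ} (Ω : Set (Space d)) (u : Space d → Space d)
    (Du : Space d → Space d →L[ℝ] Space d) : Prop :=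
  ∀ φ : Space d → ℝ, ContDiff ℝ ∞ φ → HasCompactSupport φ → tsupport φ ⊆ Ω → ∀ w : Space d,
    ∫ x in Ω, (fderiv ℝ φ x w) • u x = - ∫ x in Ω, φ x • Du x w

/-- `u ∈ W^{1,p}(Ω; ℝ^d)`, for `1 ≤ p ≤ ∞`. -/
def MemW1p {d : ℕ} (u : Space d → Space d) (p : ℝ≥0∞) (Ω : Set (Space d)) : Prop :=
  MemLp u p (volume.restrict Ω) ∧
    ∃ Du : Space d → Space d →L[ℝ] Space d,
      MemLp Du p (volume.restrict Ω) ∧ HasWeakGradient Ω u Du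

/-- `u ∈ W_0^{1,p}(Ω; ℝ^d)`, the closure of `C_c^∞(Ω; ℝ^d)` in `W^{1,p}(Ω; ℝ^d)`. -/
def MemW1pZero {d : ℕ} (u : Space d → Space d) (p : ℝ≥0∞) (Ω : Set (Space d)) : Prop :=
  MemLp u p (volume.restrict Ω) ∧
    ∃ Du : Space d → Space d →L[ℝ] Space d,
      MemLp Du p (volume.restrict Ω) ∧ HasWeakGradient Ω u Du ∧
      ∃ ψ : ℕ → Space d → Space d,
        (∀ j, ContDiff ℝ ∞ (ψ j) ∧ HasCompactSupport (ψ j) ∧ tsupport (ψ j) ⊆ Ω) ∧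
        Tendsto (fun j => eLpNorm (ψ j - u) p (volume.restrict Ω)) atTop (𝓝 0) ∧
        Tendsto (fun j => eLpNorm (fderiv ℝ (ψ j) - Du) p (volume.restrict Ω)) atTop (𝓝 0)

/-- The boundary of `Ω` is Lipschitz: near each boundary point, `Ω` is the set of points above the
graph of a Lipschitz function over the hyperplane orthogonal to some unit vector `ν`. -/
def HasLipschitzBoundary {d : ℕ} (Ω : Set (Space d)) : Prop :=
  ∀ x₀ ∈ frontier Ω, ∃ (ν : Space d) (r : ℝ) (K : ℝ≥0) (γ : Space d → ℝ),
    ‖ν‖ = 1 ∧ 0 < r ∧ LipschitzWith K γ ∧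
    ∀ x ∈ Metric.ball x₀ r, (x ∈ Ω ↔ γ (x - inner ℝ ν x • ν) < inner ℝ ν x)

/-! ### The lattice, its cells, and lattice subsets of a set -/

/-- The image `A t = ∑ i, t_i v_i` of `t ∈ ℝ^d` under the matrix `A = (v_1, …, v_d)`. -/
def applyA {d : ℕ} (v : Fin d → Space d) (t : Fin d → ℝ) : Space d := ∑ i, t i • v i

/-- The corners `z_s ∈ A {-1/2, 1/2}^d` of the unit cell centered at `0`. There are `2^d` of them,
indexed by `s ∈ {false, true}^d`. -/
noncomputable def corner {d : ℕ} (v : Fin d → Space d) (s : Fin d → Bool) : Space d :=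
  applyA v (fun i => if s i then 1 / 2 else -(1 / 2))

/-- The centers `ε A ℤ^d + ε A (1/2, …, 1/2)` of the cells of the scaled lattice. -/
def centers {d : ℕ} (v : Fin d → Space d) (ε : ℝ) : Set (Space d) :=
  {c | ∃ n : Fin d → ℤ, c = ε • applyA v (fun i => (n i : ℝ)) + ε • applyA v (fun _ => 1 / 2)}

/-- The half-open `ε`-cell `c + ε A [-1/2, 1/2)^d` with center `c`. If `c = z + ε A (1/2, …, 1/2)`
with `z` in the scaled lattice, then this is `z + A [0, ε)^d`. -/
def cell {d : ℕ} (v : Fin d → Space d) (ε : ℝ) (c : Space d) : Set (Space d) :=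
  {a | ∃ t : Fin d → ℝ, (∀ i, -(1 / 2) ≤ t i ∧ t i < 1 / 2) ∧ a = c + ε • applyA v t}

/-- Centers of the cells whose closure meets `U`. -/
def outerCenters {d : ℕ} (v : Fin d → Space d) (ε : ℝ) (U : Set (Space d)) : Set (Space d) :=
  {c | c ∈ centers v ε ∧ (closure (cell v ε c) ∩ U).Nonempty}

/-- Centers of the cells whose closure is contained in `U`. -/
def innerCenters {d : ℕ} (v : Fin d → Space d) (ε : ℝ) (U : Set (Space d)) : Set (Space d) :=
  {c | c ∈ centers v ε ∧ closure (cell v ε c) ⊆ U}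

/-- Centers of the boundary cells of `U`. -/
def boundaryCenters {d : ℕ} (v : Fin d → Space d) (ε : ℝ) (U : Set (Space d)) : Set (Space d) :=
  outerCenters v ε U \ innerCenters v ε U

/-- The lattice boundary of `U`: all corners of the boundary cells of `U`. -/
def latticeBoundary {d : ℕ} (v : Fin d → Space d) (ε : ℝ) (U : Set (Space d)) : Set (Space d) :=
  {x | ∃ c ∈ boundaryCenters v ε U, ∃ s : Fin d → Bool, x = c + ε • corner v s}

/-! ### Lattice deformations and energies

Deformations are functions on `U`; they are written as functions on the whole space, but only their
values on `U` enter. -/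

/-- Lattice deformations of `U`: functions on `U` that are constant on every cell. -/
def latticeDeformations {d : ℕ} (v : Fin d → Space d) (ε : ℝ) (U : Set (Space d)) :
    Set (Space d → Space d) :=
  {y | ∀ c ∈ outerCenters v ε U, ∀ a ∈ cell v ε c ∩ U, ∀ b ∈ cell v ε c ∩ U, y a = y b}

/-- Lattice deformations `y` of `U` with `y(x) = g(x̄)` for all `x` in the lattice boundary of `U`,
where `x̄` is the center of the cell containing `x`. As `y` is constant on cells, its value at a
point `x` of the lattice boundary (which may lie outside `U`) is its value on the part in `U` of the
cell containing `x`; there is no condition if that part is empty. -/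
def latticeDeformationsBdry {d : ℕ} (v : Fin d → Space d) (ε : ℝ) (U : Set (Space d))
    (g : Space d → Space d) : Set (Space d → Space d) :=
  {y | y ∈ latticeDeformations v ε U ∧
    ∀ x ∈ latticeBoundary v ε U, ∀ c ∈ centers v ε, x ∈ cell v ε c →
      ∀ a ∈ cell v ε c ∩ U, y a = g c}

/-- The space `ℝ^{d × 2^d}` with the Frobenius norm; the entry at `s` is the column of the
corner `z_s`. -/
abbrev DiscreteGradient (d : ℕ) : Type := PiLp 2 (fun _ : Fin d → Bool => Space d)

/-- The subspace `V_0` of matrices whose columns add up to zero. -/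
def V0 (d : ℕ) : Set (DiscreteGradient d) := {F | ∑ s, F s = 0}

/-- The average of `y` over the corners of the `ε`-cell with center `c`. -/
noncomputable def cornerAverage {d : ℕ} (v : Fin d → Space d) (ε : ℝ) (y : Space d → Space d)
    (c : Space d) : Space d :=
  ((2 : ℝ) ^ d)⁻¹ • ∑ s : Fin d → Bool, y (c + ε • corner v s)

/-- The discrete gradient of `y` on the `ε`-cell with center `c`. -/
noncomputable def discreteGradient {d : ℕ} (v : Fin d → Space d) (ε : ℝ) (y : Space d → Space d)
    (c : Space d) : DiscreteGradient d :=
  WithLp.toLp 2 (fun s => ε⁻¹ • (y (c + ε • corner v s) - cornerAverage v ε y c))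

open Classical in
/-- The energy `F_ε(y, U)`: `ε^d` times the sum of the cell energies over all inner cells of `U` if
`y` is a lattice deformation of `U`, and `∞` otherwise. -/
noncomputable def energy {d : ℕ} (v : Fin d → Space d) (W : DiscreteGradient d → ℝ≥0) (ε : ℝ)
    (y : Space d → Space d) (U : Set (Space d)) : ℝ≥0∞ :=
  if y ∈ latticeDeformations v ε U then
    ENNReal.ofReal (ε ^ d) *
      ∑' c : innerCenters v ε U, (W (discreteGradient v ε y (c : Space d)) : ℝ≥0∞)
  else ⊤

open Classical in
/-- The energy `F_ε^g(y, U)` under the boundary condition `g`. -/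
noncomputable def energyBdry {d : ℕ} (v : Fin d → Space d) (W : DiscreteGradient d → ℝ≥0)
    (g : Space d → Space d) (ε : ℝ) (y : Space d → Space d) (U : Set (Space d)) : ℝ≥0∞ :=
  if y ∈ latticeDeformationsBdry v ε U g then energy v W ε y U else ⊤

end Atomistic

open Atomistic

/-!
Let `y` have finite energy at scale `ε`, and consider the lattice function `Z` whose value on a
cell is the value of `y` minus the value of `g` at the center. The boundary condition makes `Z`
vanish at *all* corners of every cell that is not an inner cell
(`latticeDifference_corner_eq_zero`). Hence a smooth interpolation `ζ` of `Z`, in which the value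
and gradient on a cell depend only on the corners of that cell (`exists_smooth_interpolation`), is
a test function with compact support in `Ω`. On inner cells the differences of `Z`
are controlled by the discrete gradient of `y` and the Lipschitz constant of `g`
(`MemW1p.exists_lipschitz_const`), so coercivity of the cell energy bounds `∇ζ` in `L^p`, while
`y - g - ζ` is of order `ε` in `L^p(Ω)` (`exists_testFunction_approx`).

It remains to pass to the limit in a sequence of test functions with bounded gradients. A
subsequence converges in `L^p` by Rellich's theorem (`exists_subseq_tendsto_eLpNorm`), which is
proved by comparison with averages over the cells of a fine lattice. That the limit lies in
`W_0^{1,p}(Ω)` is a form of Mazur's lemma (`memW1pZero_of_tendsto`): among the test functions close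
to the limit in `L^p`, almost-minimizers of the `L^p` norm of the gradient have gradients forming a
Cauchy sequence, because of the uniform convexity expressed by `exists_midpoint_const`.
-/

namespace Atomistic

variable {d : ℕ}

/-! ### Tiling of space by the cells of a scaled lattice -/

/-- The integer coordinates of the half-open `ε`-cell `ε Φ⁻¹(n + [0, 1)^d)` that contains `x`,
where the linear coordinates `Φ` map the lattice to `ℤ^d`. -/
noncomputable def cellIndex {d : ℕ} (Φ : Space d ≃L[ℝ] (Fin d → ℝ)) (ε : ℝ) (x : Space d) :
    Fin d → ℤ :=
  fun i => ⌊Φ x i / ε⌋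

/-- The volume of the unit cell `Φ⁻¹([0, 1)^d)`. -/
noncomputable def cellVolume {d : ℕ} (Φ : Space d ≃L[ℝ] (Fin d → ℝ)) : ℝ≥0∞ :=
  volume (cellIndex Φ 1 ⁻¹' {0})

lemma measurable_cellIndex (Φ : Space d ≃L[ℝ] (Fin d → ℝ)) (ε : ℝ) :
    Measurable (cellIndex Φ ε) := by
  refine measurable_pi_lambda _ fun i => ?_
  refine Int.measurable_floor.comp ?_
  have : Continuous fun x : Space d => Φ x i / ε := by fun_prop
  exact this.measurable

lemma cellIndex_eq_iff (Φ : Space d ≃L[ℝ] (Fin d → ℝ)) {ε : ℝ} (hε : 0 < ε) (x : Space d)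
    (n : Fin d → ℤ) :
    cellIndex Φ ε x = n ↔ ∀ i, ε * n i ≤ Φ x i ∧ Φ x i < ε * (n i + 1) := by
  rw [funext_iff]
  refine forall_congr' fun i => ?_
  rw [cellIndex, Int.floor_eq_iff, le_div_iff₀ hε, div_lt_iff₀ hε, mul_comm ε, mul_comm ε]

open scoped Pointwise in
lemma volume_cellIndex_preimage (Φ : Space d ≃L[ℝ] (Fin d → ℝ)) {ε : ℝ} (hε : 0 < ε)
    (n : Fin d → ℤ) :
    volume (cellIndex Φ ε ⁻¹' {n}) = ENNReal.ofReal (ε ^ d) * cellVolume Φ := by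
  have h1 : cellIndex Φ ε ⁻¹' {n} =
      (fun x => x + -(ε • Φ.symm (fun i => (n i : ℝ)))) ⁻¹' (ε • (cellIndex Φ 1 ⁻¹' {0})) := by
    ext x
    rw [Set.mem_preimage, Set.mem_preimage, Set.mem_smul_set_iff_inv_smul_mem₀ hε.ne',
      Set.mem_preimage, Set.mem_singleton_iff, Set.mem_singleton_iff,
      cellIndex_eq_iff Φ hε, cellIndex_eq_iff Φ one_pos]
    refine forall_congr' fun i => ?_
    have h2 : Φ (ε⁻¹ • (x + -(ε • Φ.symm (fun i => (n i : ℝ))))) i = (Φ x i - ε * n i) / ε := by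
      simp only [map_smul, map_add, map_neg, ContinuousLinearEquiv.apply_symm_apply,
        Pi.smul_apply, Pi.add_apply, Pi.neg_apply, smul_eq_mul]
      ring
    rw [h2, le_div_iff₀ hε, div_lt_iff₀ hε]
    simp only [Pi.zero_apply, Int.cast_zero, mul_zero, zero_mul, zero_add, one_mul]
    constructor <;> rintro ⟨h3, h4⟩ <;> constructor <;> linarith
  rw [h1, measure_preimage_add_right, Measure.addHaar_smul_of_nonneg _ hε.le]
  simp [cellVolume]

lemma cellVolume_ne_top (Φ : Space d ≃L[ℝ] (Fin d → ℝ)) : cellVolume Φ ≠ ⊤ := by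
  have hc : IsCompact (Φ.symm '' Set.pi Set.univ fun _ => Set.Icc (0 : ℝ) 1) :=
    (isCompact_univ_pi fun _ => isCompact_Icc).image Φ.symm.continuous
  refine ne_top_of_le_ne_top hc.measure_lt_top.ne (measure_mono ?_)
  intro x hx
  rw [Set.mem_preimage, Set.mem_singleton_iff, cellIndex_eq_iff Φ one_pos] at hx
  refine ⟨Φ x, fun i _ => ?_, by simp⟩
  have := hx i
  simp only [Pi.zero_apply, Int.cast_zero, mul_zero, zero_add, one_mul] at this
  exact ⟨this.1, this.2.le⟩

lemma cellVolume_ne_zero (Φ : Space d ≃L[ℝ] (Fin d → ℝ)) : cellVolume Φ ≠ 0 := by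
  have ho : IsOpen (Φ ⁻¹' Set.pi Set.univ fun _ => Set.Ioo (0 : ℝ) 1) :=
    (isOpen_set_pi Set.finite_univ fun _ _ => isOpen_Ioo).preimage Φ.continuous
  have hne : (Φ ⁻¹' Set.pi Set.univ fun _ => Set.Ioo (0 : ℝ) 1).Nonempty :=
    ⟨Φ.symm fun _ => 1 / 2, fun i _ => by simp; norm_num⟩
  refine fun h => (ho.measure_pos volume hne).ne' (measure_mono_null ?_ h)
  intro x hx
  rw [Set.mem_preimage, Set.mem_singleton_iff, cellIndex_eq_iff Φ one_pos]
  intro i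
  have := hx i trivial
  simp only [Pi.zero_apply, Int.cast_zero, mul_zero, zero_add, one_mul]
  exact ⟨this.1.le, this.2⟩

/-- The integral of a function of the cell index is the sum of its values times the cell volume. -/
lemma lintegral_comp_cellIndex (Φ : Space d ≃L[ℝ] (Fin d → ℝ)) {ε : ℝ} (hε : 0 < ε)
    (a : (Fin d → ℤ) → ℝ≥0∞) :
    ∫⁻ x, a (cellIndex Φ ε x) = cellVolume Φ * (ENNReal.ofReal (ε ^ d) * ∑' n, a n) := by
  rw [← lintegral_map (measurable_of_countable a) (measurable_cellIndex Φ ε), lintegral_countable',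
    ← mul_assoc, ← ENNReal.tsum_mul_left]
  refine tsum_congr fun n => ?_
  rw [Measure.map_apply (measurable_cellIndex Φ ε) (measurableSet_singleton n),
    volume_cellIndex_preimage Φ hε]
  ring

/-- Only finitely many cells meet a bounded set. -/
lemma finite_cellIndex_image (Φ : Space d ≃L[ℝ] (Fin d → ℝ)) {ε : ℝ} (hε : 0 < ε)
    {Ω : Set (Space d)} (hΩ : Bornology.IsBounded Ω) : (cellIndex Φ ε '' Ω).Finite := by
  obtain ⟨R, hR⟩ := hΩ.subset_closedBall 0
  have hc : IsCompact (Φ '' Metric.closedBall 0 R) :=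
    (isCompact_closedBall 0 R).image Φ.continuous
  obtain ⟨M, hM⟩ := hc.isBounded.exists_norm_le
  refine (Set.finite_Icc (fun _ : Fin d => ⌊-M / ε⌋) (fun _ : Fin d => ⌊M / ε⌋)).subset ?_
  rintro _ ⟨x, hx, rfl⟩
  have hb : ∀ i, |Φ x i| ≤ M := fun i =>
    (norm_le_pi_norm (Φ x) i).trans (hM _ ⟨x, hR hx, rfl⟩)
  refine ⟨fun i => ?_, fun i => ?_⟩
  · exact Int.floor_le_floor (by have := (abs_le.1 (hb i)).1; gcongr)
  · exact Int.floor_le_floor (by have := (abs_le.1 (hb i)).2; gcongr)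

/-- Two points of the same `ε`-cell are at distance at most a multiple of `ε`. -/
lemma exists_norm_sub_le_of_cellIndex_eq (Φ : Space d ≃L[ℝ] (Fin d → ℝ)) :
    ∃ R : ℝ, 0 < R ∧ ∀ ε : ℝ, 0 < ε → ∀ x z : Space d, cellIndex Φ ε x = cellIndex Φ ε z →
      ‖x - z‖ ≤ R * ε := by
  refine ⟨‖(Φ.symm : (Fin d → ℝ) →L[ℝ] Space d)‖ + 1, by positivity, fun ε hε x z h => ?_⟩
  have h1 : ‖Φ x - Φ z‖ ≤ ε := by
    refine (pi_norm_le_iff_of_nonneg hε.le).2 fun i => ?_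
    have hx := (cellIndex_eq_iff Φ hε x _).1 h i
    have hz := (cellIndex_eq_iff Φ hε z _).1 rfl i
    rw [Pi.sub_apply, Real.norm_eq_abs, abs_le]
    constructor <;> nlinarith
  have h2 : x - z = (Φ.symm : (Fin d → ℝ) →L[ℝ] Space d) (Φ x - Φ z) := by simp
  rw [h2]
  refine ((Φ.symm : (Fin d → ℝ) →L[ℝ] Space d).le_opNorm _).trans ?_
  have := norm_nonneg (Φ.symm : (Fin d → ℝ) →L[ℝ] Space d)
  nlinarith

/-! ### Smooth interpolation of lattice functions -/

/-- A smooth hat function: it is supported in `[-3/4, 3/4]`, and its integer translates add up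
to `1`. The smooth step it is built from is constant near `0` and near `1`, so that the identities
for its translates hold on a neighborhood of the closed unit cell and can be differentiated there. -/
noncomputable def smoothHat (t : ℝ) : ℝ :=
  Real.smoothTransition (2 * (t + 1) - 1 / 2) - Real.smoothTransition (2 * t - 1 / 2)

/-- The tensor product of `d` smooth hats. -/
noncomputable def hatProd (t : Fin d → ℝ) : ℝ := ∏ i, smoothHat (t i)

/-- The integer vector in `{0, 1}^d` encoded by `s`. -/
def cornerShift (s : Fin d → Bool) : Fin d → ℤ := fun i => if s i then 1 else 0

/-- The oscillation of a lattice function over the corners of the cell `m`. -/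
noncomputable def cornerOsc {E : Type*} [SeminormedAddCommGroup E] (Z : (Fin d → ℤ) → E)
    (m : Fin d → ℤ) : ℝ :=
  ∑ s : Fin d → Bool, ‖Z (m + cornerShift s) - Z m‖

lemma cornerOsc_nonneg {E : Type*} [SeminormedAddCommGroup E] (Z : (Fin d → ℤ) → E)
    (m : Fin d → ℤ) : 0 ≤ cornerOsc Z m :=
  Finset.sum_nonneg fun _ _ => norm_nonneg _

lemma contDiff_smoothHat : ContDiff ℝ ∞ smoothHat := by
  unfold smoothHat
  exact (Real.smoothTransition.contDiff.comp (by fun_prop)).sub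
    (Real.smoothTransition.contDiff.comp (by fun_prop))

lemma contDiff_hatProd : ContDiff ℝ ∞ (hatProd : (Fin d → ℝ) → ℝ) := by
  unfold hatProd
  refine contDiff_prod fun i _ => ?_
  exact contDiff_smoothHat.comp (contDiff_apply ℝ ℝ i)

lemma smoothHat_nonneg (t : ℝ) : 0 ≤ smoothHat t :=
  sub_nonneg.2 (Real.smoothTransition.monotone (by linarith))

lemma smoothHat_le_one (t : ℝ) : smoothHat t ≤ 1 := by
  have h1 := Real.smoothTransition.le_one (2 * (t + 1) - 1 / 2)
  have h2 := Real.smoothTransition.nonneg (2 * t - 1 / 2)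
  unfold smoothHat
  linarith

lemma smoothHat_eq_zero_of_le {t : ℝ} (ht : t ≤ -(3 / 4)) : smoothHat t = 0 := by
  rw [smoothHat, Real.smoothTransition.zero_of_nonpos (by linarith),
    Real.smoothTransition.zero_of_nonpos (by linarith), sub_zero]

lemma smoothHat_eq_zero_of_ge {t : ℝ} (ht : 3 / 4 ≤ t) : smoothHat t = 0 := by
  rw [smoothHat, Real.smoothTransition.one_of_one_le (by linarith),
    Real.smoothTransition.one_of_one_le (by linarith), sub_self]

lemma smoothHat_add {t : ℝ} (h0 : -(1 / 4) ≤ t) (h1 : t ≤ 5 / 4) :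
    smoothHat t + smoothHat (t - 1) = 1 := by
  rw [smoothHat, smoothHat, Real.smoothTransition.one_of_one_le (x := 2 * (t + 1) - 1 / 2)
    (by linarith), Real.smoothTransition.zero_of_nonpos (x := 2 * (t - 1) - 1 / 2) (by linarith)]
  ring_nf

lemma hatProd_nonneg (t : Fin d → ℝ) : 0 ≤ hatProd t :=
  Finset.prod_nonneg fun _ _ => smoothHat_nonneg _

lemma hatProd_le_one (t : Fin d → ℝ) : hatProd t ≤ 1 :=
  Finset.prod_le_one (fun _ _ => smoothHat_nonneg _) fun _ _ => smoothHat_le_one _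

lemma hasCompactSupport_hatProd : HasCompactSupport (hatProd : (Fin d → ℝ) → ℝ) := by
  refine HasCompactSupport.intro
    (isCompact_univ_pi fun _ : Fin d => isCompact_Icc (a := (-1 : ℝ)) (b := 1)) fun t ht => ?_
  obtain ⟨i, hi⟩ : ∃ i, t i ∉ Set.Icc (-1 : ℝ) 1 := by
    simpa only [Set.mem_univ_pi, not_forall] using ht
  refine Finset.prod_eq_zero (Finset.mem_univ i) ?_
  rcases not_and_or.1 hi with h | h
  · exact smoothHat_eq_zero_of_le (by linarith [not_le.1 h])
  · exact smoothHat_eq_zero_of_ge (by linarith [not_le.1 h])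

/-- Near the unit cell, the hats centered at its corners add up to `1`. -/
lemma sum_hatProd_corners {t : Fin d → ℝ} (ht : ∀ i, -(1 / 4) < t i ∧ t i < 5 / 4) :
    ∑ s : Fin d → Bool, hatProd (fun i => t i - (cornerShift s i : ℤ)) = 1 := by
  have h := Finset.prod_univ_sum (fun _ : Fin d => (Finset.univ : Finset Bool))
    (fun i b => smoothHat (t i - ((if b then 1 else 0 : ℤ) : ℝ)))
  rw [Fintype.piFinset_univ] at h
  refine h.symm.trans (Finset.prod_eq_one fun i _ => ?_)
  have := smoothHat_add (ht i).1.le (ht i).2.le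
  simp only [Fintype.sum_bool, if_true, Int.cast_one, Bool.false_eq_true, if_false, Int.cast_zero,
    sub_zero]
  linarith

/-- Near the unit cell, the hats not centered at one of its corners vanish. -/
lemma hatProd_eq_zero_of_not_corner {t : Fin d → ℝ} (ht : ∀ i, -(1 / 4) < t i ∧ t i < 5 / 4)
    {k : Fin d → ℤ} (hk : ∀ s, k ≠ cornerShift s) : hatProd (fun i => t i - (k i : ℝ)) = 0 := by
  have h1 : ∃ i, k i ≠ 0 ∧ k i ≠ 1 := by
    by_contra! hcon
    refine hk (fun i => decide (k i = 1)) (funext fun i => ?_)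
    by_cases h0 : k i = 0
    · simp [cornerShift, h0]
    · simp [cornerShift, hcon i h0]
  obtain ⟨i, h0, h1⟩ := h1
  refine Finset.prod_eq_zero (Finset.mem_univ i) ?_
  rcases lt_or_gt_of_ne h0 with h | h
  · have : (k i : ℝ) ≤ -1 := by exact_mod_cast (by omega : k i ≤ -1)
    exact smoothHat_eq_zero_of_ge (by linarith [(ht i).1])
  · have : (2 : ℝ) ≤ k i := by exact_mod_cast (by omega : 2 ≤ k i)
    exact smoothHat_eq_zero_of_le (by linarith [(ht i).2])

lemma cornerShift_injective : Function.Injective (cornerShift : (Fin d → Bool) → Fin d → ℤ) := by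
  intro s t h
  funext i
  have := congrFun h i
  unfold cornerShift at this
  cases hs : s i <;> cases ht : t i <;> simp_all

/-- The smooth interpolation at `t ∈ ℝ^d` of a function on `ℤ^d` supported in `N`. -/
noncomputable def latticeInterp {E : Type*} [AddCommGroup E] [Module ℝ E] (N : Finset (Fin d → ℤ))
    (Z : (Fin d → ℤ) → E) (t : Fin d → ℝ) : E :=
  ∑ n ∈ N, hatProd (fun i => t i - (n i : ℝ)) • Z n

/-- On a neighborhood of the cell `m`, the interpolation only sees the corner values. -/
lemma latticeInterp_eq_sum_corners {E : Type*} [AddCommGroup E] [Module ℝ E]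
    {N : Finset (Fin d → ℤ)} {Z : (Fin d → ℤ) → E} (hN : ∀ n, n ∉ N → Z n = 0) {m : Fin d → ℤ}
    {t : Fin d → ℝ} (ht : ∀ i, -(1 / 4) < t i - m i ∧ t i - m i < 5 / 4) :
    latticeInterp N Z t =
      ∑ s : Fin d → Bool, hatProd (fun i => t i - m i - (cornerShift s i : ℤ)) •
        Z (m + cornerShift s) := by
  classical
  set c : (Fin d → Bool) → Fin d → ℤ := fun s => m + cornerShift s with hc
  have hcinj : Function.Injective c := fun s s' h => cornerShift_injective (add_left_cancel h)
  have h1 : latticeInterp N Z t =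
      ∑ n ∈ N ∪ Finset.univ.image c, hatProd (fun i => t i - (n i : ℝ)) • Z n := by
    refine Finset.sum_subset Finset.subset_union_left fun n _ hn => ?_
    rw [hN n hn, smul_zero]
  have h2 : ∑ n ∈ Finset.univ.image c, hatProd (fun i => t i - (n i : ℝ)) • Z n =
      ∑ n ∈ N ∪ Finset.univ.image c, hatProd (fun i => t i - (n i : ℝ)) • Z n := by
    refine Finset.sum_subset Finset.subset_union_right fun n _ hn => ?_
    have h3 : hatProd (fun i => (t i - m i) - ((n - m) i : ℤ)) = 0 := by
      refine hatProd_eq_zero_of_not_corner ht fun s hs => hn ?_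
      exact Finset.mem_image.2 ⟨s, Finset.mem_univ s, by simp [hc, ← hs]⟩
    have h4 : (fun i => t i - (n i : ℝ)) = fun i => (t i - m i) - ((n - m) i : ℤ) := by
      funext i
      simp
    rw [h4, h3, zero_smul]
  rw [h1, ← h2, Finset.sum_image hcinj.injOn]
  refine Finset.sum_congr rfl fun s _ => ?_
  congr 2
  funext i
  simp [hc, sub_sub]

/-- The interpolation is the value at the base corner plus weighted corner differences. -/
lemma latticeInterp_eq_add_sum {E : Type*} [AddCommGroup E] [Module ℝ E]
    {N : Finset (Fin d → ℤ)} {Z : (Fin d → ℤ) → E} (hN : ∀ n, n ∉ N → Z n = 0) {m : Fin d → ℤ}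
    {t : Fin d → ℝ} (ht : ∀ i, -(1 / 4) < t i - m i ∧ t i - m i < 5 / 4) :
    latticeInterp N Z t = Z m +
      ∑ s : Fin d → Bool, hatProd (fun i => t i - m i - (cornerShift s i : ℤ)) •
        (Z (m + cornerShift s) - Z m) := by
  rw [latticeInterp_eq_sum_corners hN ht]
  simp_rw [smul_sub]
  rw [Finset.sum_sub_distrib, ← Finset.sum_smul, sum_hatProd_corners ht, one_smul,
    add_sub_cancel]

/-- **Smooth interpolation.** A finitely supported lattice function `Z` has a smooth interpolation
whose value and derivative on each cell are controlled by the differences of `Z` over the corners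
of that very cell. -/
lemma exists_smooth_interpolation (Φ : Space d ≃L[ℝ] (Fin d → ℝ)) :
    ∃ Λ : ℝ, 0 < Λ ∧ ∀ ε : ℝ, 0 < ε → ∀ Z : (Fin d → ℤ) → Space d, Z.support.Finite →
      ∃ ζ : Space d → Space d, ContDiff ℝ ∞ ζ ∧
        (∀ x, ‖ζ x - Z (cellIndex Φ ε x)‖ ≤ cornerOsc Z (cellIndex Φ ε x)) ∧
        (∀ x, ‖fderiv ℝ ζ x‖ ≤ Λ * (cornerOsc Z (cellIndex Φ ε x) / ε)) ∧
        (∀ x, ζ x ≠ 0 → ∃ s, Z (cellIndex Φ ε x + cornerShift s) ≠ 0) := by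
  obtain ⟨K, hK⟩ : ∃ K, ∀ t : Fin d → ℝ, ‖fderiv ℝ hatProd t‖ ≤ K :=
    (hasCompactSupport_hatProd.fderiv (𝕜 := ℝ)).exists_bound_of_continuous
      (contDiff_hatProd.continuous_fderiv (by simp))
  set Φ' : Space d →L[ℝ] (Fin d → ℝ) := (Φ : Space d →L[ℝ] (Fin d → ℝ)) with hΦ'
  have hK0 : 0 ≤ K := (norm_nonneg _).trans (hK 0)
  refine ⟨K * ‖Φ'‖ + 1, by positivity, fun ε hε Z hZ => ?_⟩
  have hN : ∀ n, n ∉ hZ.toFinset → Z n = 0 := fun n hn => by simpa using hn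
  set τ : Space d → Fin d → ℝ := fun x => (ε⁻¹ • Φ') x with hτ
  have hτi : ∀ x i, τ x i = Φ x i / ε := fun x i => by simp [hτ, hΦ', div_eq_inv_mul]
  have hτc : ContDiff ℝ ∞ τ := (ε⁻¹ • Φ').contDiff
  have hτm : ∀ x i, 0 ≤ τ x i - cellIndex Φ ε x i ∧ τ x i - cellIndex Φ ε x i < 1 := by
    intro x i
    rw [hτi]
    exact ⟨sub_nonneg.2 (Int.floor_le _), sub_lt_iff_lt_add'.2 (Int.lt_floor_add_one _)⟩
  have hnear : ∀ x i, -(1 / 4) < τ x i - cellIndex Φ ε x i ∧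
      τ x i - cellIndex Φ ε x i < 5 / 4 := fun x i =>
    ⟨by linarith [(hτm x i).1], by linarith [(hτm x i).2]⟩
  have hadd := fun x => latticeInterp_eq_add_sum hN (hnear x)
  refine ⟨fun x => latticeInterp hZ.toFinset Z (τ x), ?_, fun x => ?_, fun x => ?_, fun x => ?_⟩
  · unfold latticeInterp
    refine ContDiff.sum fun n _ => ?_
    refine ContDiff.fun_smul ?_ contDiff_const
    exact contDiff_hatProd.comp (contDiff_pi.2 fun i =>
      ((contDiff_apply ℝ ℝ i).comp hτc).sub contDiff_const)
  · beta_reduce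
    rw [hadd x, add_sub_cancel_left]
    refine norm_sum_le_of_le _ fun s _ => ?_
    rw [norm_smul, Real.norm_eq_abs, abs_of_nonneg (hatProd_nonneg _)]
    exact mul_le_of_le_one_left (norm_nonneg _) (hatProd_le_one _)
  · set m := cellIndex Φ ε x with hm
    have hev : (fun z => latticeInterp hZ.toFinset Z (τ z)) =ᶠ[𝓝 x] fun z => Z m +
        ∑ s : Fin d → Bool, hatProd (fun i => τ z i - m i - (cornerShift s i : ℤ)) •
          (Z (m + cornerShift s) - Z m) := by
      have hz : ∀ᶠ z in 𝓝 x, ∀ i, -(1 / 4) < τ z i - m i ∧ τ z i - m i < 5 / 4 := by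
        refine eventually_all.2 fun i => ?_
        have hc : Continuous fun z => τ z i - m i :=
          ((continuous_apply i).comp hτc.continuous).sub continuous_const
        exact hc.continuousAt.eventually (Ioo_mem_nhds (hnear x i).1 (hnear x i).2)
      filter_upwards [hz] with z hz
      exact latticeInterp_eq_add_sum hN hz
    have hder : ∀ s : Fin d → Bool, HasFDerivAt
        (fun z => hatProd (fun i => τ z i - m i - (cornerShift s i : ℤ)))
        ((fderiv ℝ hatProd (fun i => τ x i - m i - (cornerShift s i : ℤ))).comp (ε⁻¹ • Φ')) x := by
      intro s
      have h1 : HasFDerivAt (fun z => fun i => τ z i - m i - ((cornerShift s i : ℤ) : ℝ))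
          (ε⁻¹ • Φ') x := by
        have h2 := ((ε⁻¹ • Φ').hasFDerivAt (x := x)).sub_const
          (fun i => (m i : ℝ) + ((cornerShift s i : ℤ) : ℝ))
        refine h2.congr_of_eventuallyEq (Eventually.of_forall fun z => ?_)
        funext i
        simp [hτ, sub_sub]
      exact ((contDiff_hatProd.differentiable (by simp)) _).hasFDerivAt.comp x h1
    have hsum := (HasFDerivAt.fun_sum (u := Finset.univ) fun s _ =>
      (hder s).smul_const (Z (m + cornerShift s) - Z m)).const_add (Z m)
    rw [hev.fderiv_eq, hsum.fderiv, cornerOsc, Finset.sum_div, Finset.mul_sum]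
    refine norm_sum_le_of_le _ fun s _ => ?_
    rw [ContinuousLinearMap.norm_smulRight_apply]
    have h3 : ‖(fderiv ℝ hatProd (fun i => τ x i - m i - ((cornerShift s i : ℤ) : ℝ))).comp
        (ε⁻¹ • Φ')‖ ≤ (K * ‖Φ'‖ + 1) / ε := by
      refine (ContinuousLinearMap.opNorm_comp_le _ _).trans ?_
      rw [norm_smul, norm_inv, Real.norm_of_nonneg hε.le, div_eq_mul_inv, add_mul, one_mul]
      have := mul_le_mul_of_nonneg_right
        (hK (fun i => τ x i - m i - ((cornerShift s i : ℤ) : ℝ)))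
        (by positivity : 0 ≤ ε⁻¹ * ‖Φ'‖)
      have h5 : 0 < ε⁻¹ := inv_pos.2 hε
      nlinarith
    calc _ ≤ (K * ‖Φ'‖ + 1) / ε * ‖Z (m + cornerShift s) - Z m‖ :=
          mul_le_mul_of_nonneg_right h3 (norm_nonneg _)
      _ = _ := by ring
  · intro hne
    by_contra! hcon
    refine hne ?_
    show latticeInterp hZ.toFinset Z (τ x) = 0
    rw [latticeInterp_eq_sum_corners hN (hnear x)]
    exact Finset.sum_eq_zero fun s _ => by rw [hcon s, smul_zero]

/-! ### Compactness of smooth functions with bounded gradients -/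

lemma eLpNorm_rpow_eq_lintegral {α F : Type*} [MeasurableSpace α] [NormedAddCommGroup F]
    {p : ℝ} (hp : 1 < p) (μ : Measure α) (f : α → F) :
    eLpNorm f (ENNReal.ofReal p) μ ^ p = ∫⁻ x, ‖f x‖ₑ ^ p ∂μ := by
  have hp0 : 0 < p := by linarith
  rw [eLpNorm_eq_lintegral_rpow_enorm_toReal (by simpa using hp0) ENNReal.ofReal_ne_top,
    ENNReal.toReal_ofReal hp0.le, ← ENNReal.rpow_mul, one_div, inv_mul_cancel₀ hp0.ne',
    ENNReal.rpow_one]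

lemma eLpNorm_le_of_lintegral_le {α F : Type*} [MeasurableSpace α] [NormedAddCommGroup F]
    {p : ℝ} (hp : 1 < p) {μ : Measure α} {f : α → F} {c : ℝ≥0∞}
    (h : ∫⁻ x, ‖f x‖ₑ ^ p ∂μ ≤ c ^ p) : eLpNorm f (ENNReal.ofReal p) μ ≤ c := by
  rw [← eLpNorm_rpow_eq_lintegral hp] at h
  exact (ENNReal.rpow_le_rpow_iff (by linarith)).1 h

/-- Jensen's inequality for the power function and a probability measure. -/
lemma lintegral_rpow_le_of_isProbabilityMeasure {α : Type*} [MeasurableSpace α] (ν : Measure α)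
    [IsProbabilityMeasure ν] {p : ℝ} (hp : 1 < p) {f : α → ℝ≥0∞} (hf : AEMeasurable f ν) :
    (∫⁻ x, f x ∂ν) ^ p ≤ ∫⁻ x, f x ^ p ∂ν := by
  have h := ENNReal.lintegral_mul_le_Lp_mul_Lq ν (Real.HolderConjugate.conjExponent hp) hf
    (aemeasurable_const (b := (1 : ℝ≥0∞)))
  simp only [Pi.mul_apply, mul_one, ENNReal.one_rpow, lintegral_const, measure_univ] at h
  calc _ ≤ ((∫⁻ x, f x ^ p ∂ν) ^ (1 / p)) ^ p := by gcongr
    _ = _ := by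
      rw [← ENNReal.rpow_mul, one_div, inv_mul_cancel₀ (by linarith), ENNReal.rpow_one]

lemma exists_pos_mul_ofReal_rpow_le {K c : ℝ≥0∞} (hK : K ≠ ⊤) (hc : c ≠ 0) {p : ℝ} (hp : 0 < p) :
    ∃ r : ℝ, 0 < r ∧ K * ENNReal.ofReal r ^ p ≤ c := by
  have h0 : Tendsto (fun r : ℝ => K * ENNReal.ofReal r ^ p) (𝓝[>] 0) (𝓝 0) := by
    have h1 : Tendsto (fun r : ℝ => ENNReal.ofReal r ^ p) (𝓝 0) (𝓝 0) := by
      have := (ENNReal.continuous_rpow_const (y := p)).comp ENNReal.continuous_ofReal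
      have h2 := this.tendsto 0
      simpa [ENNReal.zero_rpow_of_pos hp, Function.comp_def] using h2
    have h3 := ENNReal.Tendsto.const_mul (a := K)
      (h1.mono_left (nhdsWithin_le_nhds (s := Set.Ioi 0)))
      (Or.inr hK)
    simpa using h3
  have h4 := (h0.eventually_le_const (pos_iff_ne_zero.2 hc)).and self_mem_nhdsWithin
  obtain ⟨r, hr, hr0⟩ := h4.exists
  exact ⟨r, hr0, hr⟩

/-- Translations of a `C¹` function are controlled in `L^p` by the gradient. -/
lemma lintegral_translate_sub_le {p : ℝ} (hp : 1 < p) {f : Space d → Space d}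
    (hf : ContDiff ℝ 1 f) (h : Space d) :
    ∫⁻ x, ‖f (x + h) - f x‖ₑ ^ p ≤ ‖h‖ₑ ^ p * ∫⁻ x, ‖fderiv ℝ f x‖ₑ ^ p := by
  have hfc : Continuous (fderiv ℝ f) := hf.continuous_fderiv (by simp)
  have : IsProbabilityMeasure (volume.restrict (Set.Ioc (0 : ℝ) 1)) := ⟨by simp⟩
  have hpt : ∀ x, ‖f (x + h) - f x‖ₑ ^ p ≤
      ∫⁻ t in Set.Ioc (0 : ℝ) 1, ‖fderiv ℝ f (x + t • h)‖ₑ ^ p * ‖h‖ₑ ^ p := by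
    intro x
    have hd : ∀ t ∈ Set.uIcc (0 : ℝ) 1,
        HasDerivAt (fun t : ℝ => f (x + t • h)) (fderiv ℝ f (x + t • h) h) t := by
      intro t _
      have h1 : HasDerivAt (fun t : ℝ => x + t • h) h t := by
        simpa using ((hasDerivAt_id t).smul_const h).const_add x
      exact ((hf.differentiable (by simp)) _).hasFDerivAt.comp_hasDerivAt t h1
    have hcont : Continuous fun t : ℝ => fderiv ℝ f (x + t • h) h :=
      (hfc.comp (by fun_prop)).clm_apply continuous_const
    have hint := intervalIntegral.integral_eq_sub_of_hasDerivAt hd (hcont.intervalIntegrable 0 1)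
    rw [one_smul, zero_smul, add_zero, intervalIntegral.integral_of_le zero_le_one] at hint
    rw [← hint]
    calc _ ≤ (∫⁻ t in Set.Ioc (0 : ℝ) 1, ‖fderiv ℝ f (x + t • h) h‖ₑ) ^ p := by
          gcongr
          exact enorm_integral_le_lintegral_enorm _
      _ ≤ ∫⁻ t in Set.Ioc (0 : ℝ) 1, ‖fderiv ℝ f (x + t • h) h‖ₑ ^ p :=
          lintegral_rpow_le_of_isProbabilityMeasure _ hp hcont.enorm.aemeasurable
      _ ≤ _ := by
          refine lintegral_mono fun t => ?_
          rw [← ENNReal.mul_rpow_of_nonneg _ _ (by linarith)]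
          gcongr
          exact ContinuousLinearMap.le_opENorm _ _
  have hc2 : Continuous fun z : Space d × ℝ => fderiv ℝ f (z.1 + z.2 • h) :=
    hfc.comp (by fun_prop)
  calc _ ≤ ∫⁻ x, ∫⁻ t in Set.Ioc (0 : ℝ) 1, ‖fderiv ℝ f (x + t • h)‖ₑ ^ p * ‖h‖ₑ ^ p :=
        lintegral_mono hpt
    _ = ∫⁻ t in Set.Ioc (0 : ℝ) 1, ∫⁻ x, ‖fderiv ℝ f (x + t • h)‖ₑ ^ p * ‖h‖ₑ ^ p :=
        lintegral_lintegral_swap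
          ((hc2.enorm.measurable.pow_const p).mul_const _).aemeasurable
    _ = ∫⁻ t in Set.Ioc (0 : ℝ) 1, (∫⁻ x, ‖fderiv ℝ f x‖ₑ ^ p) * ‖h‖ₑ ^ p := by
        refine lintegral_congr fun t => ?_
        have hm : Measurable fun x => ‖fderiv ℝ f (x + t • h)‖ₑ ^ p :=
          (hfc.comp (continuous_add_const _)).enorm.measurable.pow_const p
        rw [lintegral_mul_const _ hm,
          lintegral_add_right_eq_self (fun x => ‖fderiv ℝ f x‖ₑ ^ p)]
    _ = _ := by
        rw [lintegral_const, Measure.restrict_apply_univ, Real.volume_Ioc]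
        simp [mul_comm]

/-- **Poincaré's inequality** for functions vanishing outside a bounded set. -/
lemma exists_poincare_const {p : ℝ} (hp : 1 < p) {Ω : Set (Space d)}
    (hΩ : Bornology.IsBounded Ω) :
    ∃ C : ℝ≥0∞, C ≠ ⊤ ∧ ∀ f : Space d → Space d, ContDiff ℝ 1 f → (∀ x, x ∉ Ω → f x = 0) →
      ∫⁻ x, ‖f x‖ₑ ^ p ≤ C * ∫⁻ x, ‖fderiv ℝ f x‖ₑ ^ p := by
  have hp0 : 0 < p := by linarith
  rcases subsingleton_or_nontrivial (Space d) with hd | hd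
  · refine ⟨0, by simp, fun f _ _ => ?_⟩
    have : ∀ x, f x = 0 := fun x => Subsingleton.elim _ _
    simp [this, hp0]
  obtain ⟨R, hR0, hR⟩ := hΩ.subset_ball_lt 0 0
  obtain ⟨h, hh⟩ := exists_norm_eq (Space d) (by positivity : 0 ≤ 2 * R)
  refine ⟨‖h‖ₑ ^ p, by finiteness, fun f hf h0 => ?_⟩
  refine le_trans (lintegral_mono fun x => ?_) (lintegral_translate_sub_le hp hf h)
  by_cases hx : x ∈ Ω
  · -- a translation by more than the diameter moves the support off itself
    have hxh : x + h ∉ Ω := fun hxh => by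
      have h1 := mem_ball_zero_iff.1 (hR hx)
      have h2 := mem_ball_zero_iff.1 (hR hxh)
      have h3 : ‖h‖ ≤ ‖x + h‖ + ‖x‖ := by simpa using norm_sub_le (x + h) x
      linarith
    rw [h0 _ hxh, zero_sub, enorm_neg]
  · simp [h0 x hx, hp0]

/-- The average of `f` over the `δ`-cell with index `n`. -/
noncomputable def cellAverage (Φ : Space d ≃L[ℝ] (Fin d → ℝ)) (δ : ℝ) (f : Space d → Space d)
    (n : Fin d → ℤ) : Space d :=
  ∫ z, f z ∂ProbabilityTheory.cond volume (cellIndex Φ δ ⁻¹' {n})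

lemma volume_cell_ne (Φ : Space d ≃L[ℝ] (Fin d → ℝ)) {δ : ℝ} (hδ : 0 < δ) (n : Fin d → ℤ) :
    volume (cellIndex Φ δ ⁻¹' {n}) ≠ 0 ∧ volume (cellIndex Φ δ ⁻¹' {n}) ≠ ⊤ := by
  rw [volume_cellIndex_preimage Φ hδ]
  refine ⟨mul_ne_zero ?_ (cellVolume_ne_zero Φ),
    ENNReal.mul_ne_top ENNReal.ofReal_ne_top (cellVolume_ne_top Φ)⟩
  simpa using pow_pos hδ d

lemma isProbabilityMeasure_cond_cell (Φ : Space d ≃L[ℝ] (Fin d → ℝ)) {δ : ℝ} (hδ : 0 < δ)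
    (n : Fin d → ℤ) :
    IsProbabilityMeasure (ProbabilityTheory.cond volume (cellIndex Φ δ ⁻¹' {n})) :=
  ProbabilityTheory.cond_isProbabilityMeasure_of_finite (volume_cell_ne Φ hδ n).1
    (volume_cell_ne Φ hδ n).2

lemma lintegral_cond_cell (Φ : Space d ≃L[ℝ] (Fin d → ℝ)) {δ : ℝ} (hδ : 0 < δ) (n : Fin d → ℤ)
    (F : Space d → ℝ≥0∞) :
    ∫⁻ z, F z ∂ProbabilityTheory.cond volume (cellIndex Φ δ ⁻¹' {n}) =
      (ENNReal.ofReal (δ ^ d) * cellVolume Φ)⁻¹ * ∫⁻ z in cellIndex Φ δ ⁻¹' {n}, F z := by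
  rw [ProbabilityTheory.cond, lintegral_smul_measure, volume_cellIndex_preimage Φ hδ, smul_eq_mul]

lemma enorm_cellAverage_rpow_le (Φ : Space d ≃L[ℝ] (Fin d → ℝ)) {δ : ℝ} (hδ : 0 < δ)
    {p : ℝ} (hp : 1 < p) {f : Space d → Space d} (hf : Continuous f) (n : Fin d → ℤ) :
    ‖cellAverage Φ δ f n‖ₑ ^ p ≤
      (ENNReal.ofReal (δ ^ d) * cellVolume Φ)⁻¹ * ∫⁻ z, ‖f z‖ₑ ^ p := by
  have := isProbabilityMeasure_cond_cell Φ hδ n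
  calc _ ≤ (∫⁻ z, ‖f z‖ₑ ∂ProbabilityTheory.cond volume (cellIndex Φ δ ⁻¹' {n})) ^ p := by
        gcongr
        exact enorm_integral_le_lintegral_enorm _
    _ ≤ ∫⁻ z, ‖f z‖ₑ ^ p ∂ProbabilityTheory.cond volume (cellIndex Φ δ ⁻¹' {n}) :=
        lintegral_rpow_le_of_isProbabilityMeasure _ hp hf.enorm.aemeasurable
    _ ≤ _ := by
        rw [lintegral_cond_cell Φ hδ]
        gcongr
        exact Measure.restrict_le_self

/-- Replacing a function by its cell averages costs, in `L^p`, at most the cell diameter times the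
norm of the gradient. -/
lemma exists_cellAverage_const (Φ : Space d ≃L[ℝ] (Fin d → ℝ)) {p : ℝ} (hp : 1 < p) :
    ∃ C : ℝ≥0∞, C ≠ ⊤ ∧ ∀ δ : ℝ, 0 < δ → ∀ f : Space d → Space d, ContDiff ℝ 1 f →
      HasCompactSupport f →
      ∫⁻ x, ‖f x - cellAverage Φ δ f (cellIndex Φ δ x)‖ₑ ^ p ≤
        C * ENNReal.ofReal δ ^ p * ∫⁻ x, ‖fderiv ℝ f x‖ₑ ^ p := by
  have hp0 : 0 < p := by linarith
  obtain ⟨R, hR0, hR⟩ := exists_norm_sub_le_of_cellIndex_eq Φ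
  set B : ℝ≥0∞ := volume (Metric.closedBall (0 : Space d) R) with hB
  have hBtop : B ≠ ⊤ := (isCompact_closedBall _ _).measure_lt_top.ne
  refine ⟨(cellVolume Φ)⁻¹ * B * ENNReal.ofReal R ^ p, ?_, fun δ hδ f hf hfs => ?_⟩
  · have := cellVolume_ne_zero Φ
    exact ENNReal.mul_ne_top (ENNReal.mul_ne_top (by simpa using this) hBtop)
      (ENNReal.rpow_ne_top_of_nonneg hp0.le ENNReal.ofReal_ne_top)
  set κ : ℝ≥0∞ := ENNReal.ofReal (δ ^ d) * cellVolume Φ with hκ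
  set D : Set (Space d) := Metric.closedBall 0 (R * δ) with hD
  have hDm : MeasurableSet D := Metric.isClosed_closedBall.measurableSet
  have hpt : ∀ x, ‖f x - cellAverage Φ δ f (cellIndex Φ δ x)‖ₑ ^ p ≤
      κ⁻¹ * ∫⁻ h in D, ‖f (x + h) - f x‖ₑ ^ p := by
    intro x
    set n := cellIndex Φ δ x with hn
    have := isProbabilityMeasure_cond_cell Φ hδ n
    have hav : f x - cellAverage Φ δ f n =
        ∫ z, (f x - f z) ∂ProbabilityTheory.cond (volume : Measure (Space d))
          (cellIndex Φ δ ⁻¹' {n}) := by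
      rw [integral_sub (integrable_const _)]
      · simp [cellAverage]
      · refine Integrable.mono_measure (ν := (volume (cellIndex Φ δ ⁻¹' {n}))⁻¹ • volume) ?_ ?_
        · refine (hf.continuous.integrable_of_hasCompactSupport hfs).smul_measure ?_
          simpa using (volume_cell_ne Φ hδ n).1
        · exact Measure.le_iff.2 fun s _ => by
            simp only [ProbabilityTheory.cond, Measure.smul_apply, smul_eq_mul]
            exact mul_le_mul_right (Measure.restrict_le_self s) _
    calc _ ≤ (∫⁻ z, ‖f x - f z‖ₑ ∂ProbabilityTheory.cond volume (cellIndex Φ δ ⁻¹' {n})) ^ p := by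
          rw [hav]
          gcongr
          exact enorm_integral_le_lintegral_enorm _
      _ ≤ ∫⁻ z, ‖f x - f z‖ₑ ^ p ∂ProbabilityTheory.cond volume (cellIndex Φ δ ⁻¹' {n}) :=
          lintegral_rpow_le_of_isProbabilityMeasure _ hp
            (continuous_const.sub hf.continuous).enorm.aemeasurable
      _ ≤ κ⁻¹ * ∫⁻ z, D.indicator (fun h => ‖f (x + h) - f x‖ₑ ^ p) (-x + z) := by
          rw [lintegral_cond_cell Φ hδ]
          refine mul_le_mul_right ?_ _
          rw [← lintegral_indicator (measurable_cellIndex Φ δ (measurableSet_singleton n))]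
          refine lintegral_mono (Set.indicator_le fun z hz => ?_)
          have hzD : -x + z ∈ D := by
            rw [hD, mem_closedBall_zero_iff, neg_add_eq_sub]
            exact hR δ hδ z x hz
          rw [Set.indicator_of_mem hzD, add_neg_cancel_left, enorm_sub_rev]
      _ = _ := by
          rw [lintegral_add_left_eq_self (μ := volume)
            (D.indicator (fun h => ‖f (x + h) - f x‖ₑ ^ p)), lintegral_indicator hDm]
  have hc2 : Continuous fun z : Space d × Space d => f (z.1 + z.2) - f z.1 :=
    (hf.continuous.comp (by fun_prop)).sub (hf.continuous.comp (by fun_prop))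
  have hδd : ENNReal.ofReal (δ ^ d) ≠ 0 := by simpa using pow_pos hδ d
  calc _ ≤ ∫⁻ x, κ⁻¹ * ∫⁻ h in D, ‖f (x + h) - f x‖ₑ ^ p := lintegral_mono hpt
    _ = κ⁻¹ * ∫⁻ x, ∫⁻ h in D, ‖f (x + h) - f x‖ₑ ^ p :=
        lintegral_const_mul _ (hc2.enorm.measurable.pow_const p).lintegral_prod_right'
    _ = κ⁻¹ * ∫⁻ h in D, ∫⁻ x, ‖f (x + h) - f x‖ₑ ^ p := by
        rw [lintegral_lintegral_swap (hc2.enorm.measurable.pow_const p).aemeasurable]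
    _ ≤ κ⁻¹ * ∫⁻ h in D, ENNReal.ofReal (R * δ) ^ p * ∫⁻ x, ‖fderiv ℝ f x‖ₑ ^ p := by
        gcongr 1
        refine setLIntegral_mono measurable_const fun h hh => ?_
        refine (lintegral_translate_sub_le hp hf h).trans ?_
        gcongr
        rw [← ofReal_norm]
        exact ENNReal.ofReal_le_ofReal (mem_closedBall_zero_iff.1 hh)
    _ = κ⁻¹ * (ENNReal.ofReal (δ ^ d) * B) * ENNReal.ofReal (R * δ) ^ p *
          ∫⁻ x, ‖fderiv ℝ f x‖ₑ ^ p := by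
        have hvol : volume D = ENNReal.ofReal (δ ^ d) * B := by
          rw [hD, hB, Measure.addHaar_closedBall _ _ (by positivity),
            Measure.addHaar_closedBall _ _ hR0.le, ← mul_assoc,
            ← ENNReal.ofReal_mul (by positivity),
            mul_pow, mul_comm (R ^ _), finrank_euclideanSpace_fin]
        rw [setLIntegral_const, hvol]
        ring
    _ = _ := by
        rw [ENNReal.ofReal_mul hR0.le, ENNReal.mul_rpow_of_nonneg _ _ hp0.le, hκ,
          ENNReal.mul_inv (Or.inl hδd) (Or.inl ENNReal.ofReal_ne_top)]
        have h1 : (ENNReal.ofReal (δ ^ d))⁻¹ * ENNReal.ofReal (δ ^ d) = 1 :=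
          ENNReal.inv_mul_cancel hδd ENNReal.ofReal_ne_top
        calc _ = ((ENNReal.ofReal (δ ^ d))⁻¹ * ENNReal.ofReal (δ ^ d)) *
              ((cellVolume Φ)⁻¹ * B * ENNReal.ofReal R ^ p * ENNReal.ofReal δ ^ p *
                ∫⁻ x, ‖fderiv ℝ f x‖ₑ ^ p) := by ring
          _ = _ := by rw [h1, one_mul]

lemma cellAverage_eq_zero (Φ : Space d ≃L[ℝ] (Fin d → ℝ)) {δ : ℝ} {f : Space d → Space d}
    {Ω : Set (Space d)} (hf : ∀ x, x ∉ Ω → f x = 0) {n : Fin d → ℤ}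
    (hn : n ∉ cellIndex Φ δ '' Ω) : cellAverage Φ δ f n = 0 := by
  refine integral_eq_zero_of_ae ?_
  have hm : MeasurableSet (cellIndex Φ δ ⁻¹' {n}) :=
    measurable_cellIndex Φ δ (measurableSet_singleton n)
  refine Measure.ae_smul_measure ((ae_restrict_iff' hm).2 (Eventually.of_forall fun x hx => ?_)) _
  exact hf x fun hxΩ => hn ⟨x, hxΩ, hx⟩

/-- At every scale `c`, finitely many members of a family of functions with bounded gradients
suffice to approximate all of them: up to a small error, they are determined by finitely many,
uniformly bounded cell averages. -/
lemma exists_finite_approx {p : ℝ} (hp : 1 < p) (Φ : Space d ≃L[ℝ] (Fin d → ℝ))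
    {Ω : Set (Space d)} (hΩ : Bornology.IsBounded Ω) (f : ℕ → Space d → Space d)
    (hf : ∀ n, ContDiff ℝ 1 (f n)) (hfs : ∀ n x, x ∉ Ω → f n x = 0) {G : ℝ≥0∞} (hG : G ≠ ⊤)
    (hfG : ∀ n, ∫⁻ x, ‖fderiv ℝ (f n) x‖ₑ ^ p ≤ G) {c : ℝ≥0∞} (hc : c ≠ 0) :
    ∃ t : Set ℕ, t.Finite ∧ ∀ n, ∃ k ∈ t, eLpNorm (f n - f k) (ENNReal.ofReal p) volume ≤ c := by
  have hp0 : 0 < p := by linarith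
  have hcs : ∀ n, HasCompactSupport (f n) := fun n =>
    HasCompactSupport.intro hΩ.isCompact_closure fun x hx =>
      hfs n x fun h => hx (subset_closure h)
  obtain ⟨C₁, hC₁, hav⟩ := exists_cellAverage_const Φ hp
  obtain ⟨C₂, hC₂, hpo⟩ := exists_poincare_const hp hΩ
  set e : ℝ≥0∞ := c / 3 with he
  have he0 : e ≠ 0 := by simp [he, hc]
  have hep : e ^ p ≠ 0 := by simp [he0, hp0.not_gt]
  obtain ⟨δ, hδ, hδe⟩ := exists_pos_mul_ofReal_rpow_le (ENNReal.mul_ne_top hC₁ hG) hep hp0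
  have hfin := finite_cellIndex_image Φ hδ hΩ
  set I := hfin.toFinset with hI
  set κ : ℝ≥0∞ := cellVolume Φ * ENNReal.ofReal (δ ^ d) with hκ
  have hκtop : κ ≠ ⊤ := ENNReal.mul_ne_top (cellVolume_ne_top Φ) ENNReal.ofReal_ne_top
  obtain ⟨r, hr, hre⟩ := exists_pos_mul_ofReal_rpow_le
    (ENNReal.mul_ne_top hκtop (ENNReal.natCast_ne_top I.card)) hep hp0
  -- the averages, as vectors of a finite-dimensional space
  set a : ℕ → I → Space d := fun n i => cellAverage Φ δ (f n) i with ha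
  obtain ⟨M, hM⟩ : ∃ M : ℝ, ∀ n, ‖a n‖ ≤ M := by
    set M' : ℝ≥0∞ := (ENNReal.ofReal (δ ^ d) * cellVolume Φ)⁻¹ * (C₂ * G) with hM'
    have hM'top : M' ≠ ⊤ := by
      refine ENNReal.mul_ne_top ?_ (ENNReal.mul_ne_top hC₂ hG)
      have := pow_pos hδ d
      simp [cellVolume_ne_zero Φ, this]
    refine ⟨(M' ^ p⁻¹).toReal, fun n => (pi_norm_le_iff_of_nonneg ENNReal.toReal_nonneg).2
      fun i => ?_⟩
    rw [← toReal_enorm]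
    refine ENNReal.toReal_mono (ENNReal.rpow_ne_top_of_nonneg (by positivity) hM'top) ?_
    rw [ENNReal.le_rpow_inv_iff hp0]
    refine (enorm_cellAverage_rpow_le Φ hδ hp (hf n).continuous i).trans ?_
    rw [hM']
    gcongr
    refine (hpo _ (hf n) (hfs n)).trans ?_
    gcongr
    exact hfG n
  have htb : TotallyBounded (Set.range a) :=
    (isCompact_closedBall (0 : I → Space d) M).totallyBounded.subset
      (by rintro _ ⟨n, rfl⟩; exact mem_closedBall_zero_iff.2 (hM n))
  obtain ⟨s, hs, hsfin, hcover⟩ := Metric.finite_approx_of_totallyBounded htb r hr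
  choose! φ hφ using fun (b : I → Space d) (hb : b ∈ s) => hs hb
  refine ⟨φ '' s, hsfin.image φ, fun n => ?_⟩
  obtain ⟨b, hb, hnb⟩ := Set.mem_iUnion₂.1 (hcover ⟨n, rfl⟩)
  refine ⟨φ b, ⟨b, hb, rfl⟩, ?_⟩
  set k := φ b with hk
  have hdist : ‖a n - a k‖ < r := by
    rw [hφ b hb, ← dist_eq_norm]
    exact hnb
  set P : ℕ → Space d → Space d := fun n x => cellAverage Φ δ (f n) (cellIndex Φ δ x) with hP
  have hPm : ∀ n, AEStronglyMeasurable (P n) volume := fun n =>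
    ((measurable_of_countable (cellAverage Φ δ (f n))).comp
      (measurable_cellIndex Φ δ)).aestronglyMeasurable
  have hfm : ∀ n, AEStronglyMeasurable (f n) volume := fun n =>
    (hf n).continuous.aestronglyMeasurable
  have h1 : ∀ n, eLpNorm (f n - P n) (ENNReal.ofReal p) volume ≤ e := by
    intro n
    refine eLpNorm_le_of_lintegral_le hp ?_
    refine (hav δ hδ (f n) (hf n) (hcs n)).trans (le_trans ?_ hδe)
    rw [mul_right_comm C₁ G]
    gcongr
    exact hfG n
  have h2 : eLpNorm (P n - P k) (ENNReal.ofReal p) volume ≤ e := by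
    refine eLpNorm_le_of_lintegral_le hp (le_trans ?_ hre)
    set D : (Fin d → ℤ) → ℝ≥0∞ := fun m =>
      ‖cellAverage Φ δ (f n) m - cellAverage Φ δ (f k) m‖ₑ ^ p with hD
    have h3 : ∫⁻ x, ‖(P n - P k) x‖ₑ ^ p = κ * ∑' m, D m := by
      rw [hκ, mul_assoc]
      exact lintegral_comp_cellIndex Φ hδ D
    have h4 : ∑' m, D m = ∑ m ∈ I, D m := tsum_eq_sum fun m hm => by
      have hm' : m ∉ cellIndex Φ δ '' Ω := by simpa [hI] using hm
      simp [hD, cellAverage_eq_zero Φ (hfs _) hm', hp0]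
    rw [h3, h4, mul_assoc κ]
    refine mul_le_mul_right ?_ _
    rw [← nsmul_eq_mul]
    refine Finset.sum_le_card_nsmul _ _ _ fun m hm => ?_
    simp only [hD]
    gcongr
    rw [← ofReal_norm]
    exact ENNReal.ofReal_le_ofReal ((norm_le_pi_norm (a n - a k) ⟨m, hm⟩).trans hdist.le)
  have hq : (1 : ℝ≥0∞) ≤ ENNReal.ofReal p := by simpa using hp.le
  calc eLpNorm (f n - f k) (ENNReal.ofReal p) volume
      = eLpNorm ((f n - P n) + (P n - P k) - (f k - P k)) (ENNReal.ofReal p) volume := by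
        congr 1
        abel
    _ ≤ eLpNorm ((f n - P n) + (P n - P k)) (ENNReal.ofReal p) volume +
          eLpNorm (f k - P k) (ENNReal.ofReal p) volume :=
        eLpNorm_sub_le (((hfm n).sub (hPm n)).add ((hPm n).sub (hPm k)))
          ((hfm k).sub (hPm k)) hq
    _ ≤ (e + e) + e := by
        gcongr
        · exact (eLpNorm_add_le ((hfm n).sub (hPm n)) ((hPm n).sub (hPm k)) hq).trans
            (add_le_add (h1 n) h2)
        · exact h1 k
    _ = c := by rw [he, ENNReal.add_thirds]

/-- **Rellich's compactness theorem** for smooth functions vanishing outside a bounded set. -/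
lemma exists_subseq_tendsto_eLpNorm {p : ℝ} (hp : 1 < p) (Φ : Space d ≃L[ℝ] (Fin d → ℝ))
    {Ω : Set (Space d)} (hΩ : Bornology.IsBounded Ω) (f : ℕ → Space d → Space d)
    (hf : ∀ n, ContDiff ℝ 1 (f n)) (hfs : ∀ n x, x ∉ Ω → f n x = 0) {G : ℝ≥0∞} (hG : G ≠ ⊤)
    (hfG : ∀ n, ∫⁻ x, ‖fderiv ℝ (f n) x‖ₑ ^ p ≤ G) :
    ∃ (k : ℕ → ℕ) (w : Space d → Space d), StrictMono k ∧
      MemLp w (ENNReal.ofReal p) volume ∧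
      Tendsto (fun n => eLpNorm (f (k n) - w) (ENNReal.ofReal p) volume) atTop (𝓝 0) := by
  have : Fact ((1 : ℝ≥0∞) ≤ ENNReal.ofReal p) := ⟨by simpa using hp.le⟩
  have hcs : ∀ n, HasCompactSupport (f n) := fun n =>
    HasCompactSupport.intro hΩ.isCompact_closure fun x hx =>
      hfs n x fun h => hx (subset_closure h)
  have hmem : ∀ n, MemLp (f n) (ENNReal.ofReal p) volume := fun n =>
    (hf n).continuous.memLp_of_hasCompactSupport (hcs n)
  set F : ℕ → Lp (Space d) (ENNReal.ofReal p) volume := fun n => (hmem n).toLp (f n) with hF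
  have htb : TotallyBounded (Set.range F) := by
    refine EMetric.totallyBounded_iff.2 fun η hη => ?_
    obtain ⟨c, hc0, hcη⟩ := exists_between hη
    obtain ⟨t, ht, hcover⟩ := exists_finite_approx hp Φ hΩ f hf hfs hG hfG hc0.ne'
    refine ⟨F '' t, ht.image F, ?_⟩
    rintro _ ⟨n, rfl⟩
    obtain ⟨k, hk, hnk⟩ := hcover n
    refine Set.mem_iUnion₂.2 ⟨F k, ⟨k, hk, rfl⟩, ?_⟩
    change edist (F n) (F k) < η
    rw [hF, Lp.edist_toLp_toLp]
    exact hnk.trans_lt hcη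
  have hcomp : IsCompact (closure (Set.range F)) :=
    htb.closure.isCompact_of_isClosed isClosed_closure
  obtain ⟨w, -, k, hk, hkw⟩ := hcomp.tendsto_subseq (x := F) fun n =>
    subset_closure ⟨n, rfl⟩
  refine ⟨k, w, hk, Lp.memLp w, ?_⟩
  have h1 := (Lp.tendsto_Lp_iff_tendsto_eLpNorm' _ _).1 hkw
  refine h1.congr fun n => eLpNorm_congr_ae ?_
  exact (MemLp.coeFn_toLp (hmem (k n))).sub (ae_eq_refl _)

/-! ### Uniform convexity of the `L^p` energy and minimizing sequences -/

lemma norm_midpoint_rpow_lt {E : Type*} [NormedAddCommGroup E] [NormedSpace ℝ E]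
    [StrictConvexSpace ℝ E] {p : ℝ} (hp : 1 < p) {a b : E} (hab : a ≠ b) :
    ‖(1 / 2 : ℝ) • (a + b)‖ ^ p < (‖a‖ ^ p + ‖b‖ ^ p) / 2 := by
  have hp0 : 0 < p := by linarith
  by_cases h : ‖a‖ = ‖b‖
  · have h1 := (norm_midpoint_lt_iff h).2 hab
    have h2 := Real.rpow_lt_rpow (norm_nonneg _) h1 hp0
    rw [← h]
    linarith
  · have h1 : ‖(1 / 2 : ℝ) • (a + b)‖ ≤ 1 / 2 * ‖a‖ + 1 / 2 * ‖b‖ := by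
      rw [norm_smul, Real.norm_of_nonneg (by norm_num), ← mul_add]
      exact mul_le_mul_of_nonneg_left (norm_add_le a b) (by norm_num)
    have h2 := Real.rpow_le_rpow (norm_nonneg _) h1 hp0.le
    have h3 := (strictConvexOn_rpow hp).2 (norm_nonneg a) (norm_nonneg b) h
      (by norm_num : (0 : ℝ) < 1 / 2) (by norm_num : (0 : ℝ) < 1 / 2) (by norm_num)
    simp only [smul_eq_mul] at h3
    linarith

/-- A pointwise form of uniform convexity: the distance of `a` and `b` is controlled by the
convexity gap of `‖·‖^p` at their midpoint, up to a small multiple of their size. -/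
lemma exists_midpoint_const {E : Type*} [NormedAddCommGroup E] [NormedSpace ℝ E]
    [FiniteDimensional ℝ E] [StrictConvexSpace ℝ E] {p : ℝ} (hp : 1 < p) {η : ℝ} (hη : 0 < η) :
    ∃ K : ℝ, 0 ≤ K ∧ ∀ a b : E, ‖a - b‖ ^ p + K * ‖(1 / 2 : ℝ) • (a + b)‖ ^ p ≤
      (η + K / 2) * (‖a‖ ^ p + ‖b‖ ^ p) := by
  have hp0 : 0 < p := by linarith
  have : ProperSpace E := FiniteDimensional.proper_real E
  -- by homogeneity it suffices to treat pairs with `‖a‖ ^ p + ‖b‖ ^ p = 1`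
  suffices h : ∃ K : ℝ, 0 ≤ K ∧ ∀ a b : E, ‖a‖ ^ p + ‖b‖ ^ p = 1 →
      ‖a - b‖ ^ p + K * ‖(1 / 2 : ℝ) • (a + b)‖ ^ p ≤ η + K / 2 by
    obtain ⟨K, hK, h⟩ := h
    refine ⟨K, hK, fun a b => ?_⟩
    set N := ‖a‖ ^ p + ‖b‖ ^ p with hN
    have hN0 : 0 ≤ N := by positivity
    rcases hN0.eq_or_lt with hN0 | hN0
    · have ha : ‖a‖ ^ p = 0 := by
        have h1 : 0 ≤ ‖a‖ ^ p := by positivity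
        have h2 : 0 ≤ ‖b‖ ^ p := by positivity
        linarith
      have hb : ‖b‖ ^ p = 0 := by linarith
      rw [Real.rpow_eq_zero (norm_nonneg _) hp0.ne', norm_eq_zero] at ha hb
      simp [ha, hb, ← hN0, Real.zero_rpow hp0.ne']
    · have hl : 0 < N ^ (-p⁻¹) := Real.rpow_pos_of_pos hN0 _
      have hsc : ∀ z : E, ‖(N ^ (-p⁻¹)) • z‖ ^ p = N⁻¹ * ‖z‖ ^ p := by
        intro z
        rw [norm_smul, Real.norm_of_nonneg hl.le, Real.mul_rpow hl.le (norm_nonneg _),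
          ← Real.rpow_mul hN0.le, neg_mul, inv_mul_cancel₀ hp0.ne', Real.rpow_neg_one]
      have h1 := h ((N ^ (-p⁻¹)) • a) ((N ^ (-p⁻¹)) • b) (by
        rw [hsc, hsc, ← mul_add, ← hN, inv_mul_cancel₀ hN0.ne'])
      rw [← smul_sub, ← smul_add, smul_comm, hsc, hsc] at h1
      have h2 := mul_le_mul_of_nonneg_right h1 hN0.le
      have h3 : (N⁻¹ * ‖a - b‖ ^ p + K * (N⁻¹ * ‖(1 / 2 : ℝ) • (a + b)‖ ^ p)) * N =
          ‖a - b‖ ^ p + K * ‖(1 / 2 : ℝ) • (a + b)‖ ^ p := by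
        field_simp
      linarith
  set S : Set (E × E) := {z | ‖z.1‖ ^ p + ‖z.2‖ ^ p = 1 ∧ η ≤ ‖z.1 - z.2‖ ^ p} with hS
  have hc1 : Continuous fun z : E × E => ‖z.1‖ ^ p + ‖z.2‖ ^ p := by fun_prop (disch := linarith)
  have hc2 : Continuous fun z : E × E => ‖z.1 - z.2‖ ^ p := by fun_prop (disch := linarith)
  have hc3 : Continuous fun z : E × E => ‖(1 / 2 : ℝ) • (z.1 + z.2)‖ ^ p := by
    fun_prop (disch := linarith)
  have hle1 : ∀ {a b : E}, ‖a‖ ^ p + ‖b‖ ^ p = 1 → ‖a‖ ≤ 1 ∧ ‖b‖ ≤ 1 := by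
    intro a b h
    have h1 : 0 ≤ ‖a‖ ^ p := by positivity
    have h2 : 0 ≤ ‖b‖ ^ p := by positivity
    constructor
    · by_contra! h3
      linarith [Real.one_lt_rpow h3 hp0]
    · by_contra! h3
      linarith [Real.one_lt_rpow h3 hp0]
  have hScl : IsClosed S :=
    (isClosed_eq hc1 continuous_const).inter (isClosed_le continuous_const hc2)
  have hScomp : IsCompact S := by
    refine (isCompact_closedBall (0 : E × E) 1).of_isClosed_subset hScl fun z hz => ?_
    rw [mem_closedBall_zero_iff, Prod.norm_def]
    exact max_le (hle1 hz.1).1 (hle1 hz.1).2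
  obtain ⟨c, hc, hcS⟩ : ∃ c : ℝ, 0 < c ∧ ∀ z ∈ S,
      c ≤ (‖z.1‖ ^ p + ‖z.2‖ ^ p) / 2 - ‖(1 / 2 : ℝ) • (z.1 + z.2)‖ ^ p := by
    rcases S.eq_empty_or_nonempty with h | h
    · exact ⟨1, one_pos, by simp [h]⟩
    · obtain ⟨z, hz, hmin⟩ := hScomp.exists_isMinOn h
        ((hc1.div_const 2).sub hc3).continuousOn
      refine ⟨_, sub_pos.2 (norm_midpoint_rpow_lt hp (a := z.1) (b := z.2) fun h => ?_),
        fun w hw => hmin hw⟩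
      have h1 := hz.2
      rw [h, sub_self, norm_zero, Real.zero_rpow hp0.ne'] at h1
      linarith
  refine ⟨2 ^ p / c, by positivity, fun a b hab => ?_⟩
  have hgap : ‖(1 / 2 : ℝ) • (a + b)‖ ^ p ≤ 1 / 2 := by
    by_cases h : a = b
    · subst h
      rw [← two_smul ℝ a, smul_smul]
      norm_num
      linarith
    · have := norm_midpoint_rpow_lt hp h
      rw [hab] at this
      exact this.le
  have hK : 0 ≤ 2 ^ p / c := by positivity
  by_cases h : η ≤ ‖a - b‖ ^ p
  · have h1 := hcS (a, b) ⟨hab, h⟩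
    simp only [hab] at h1
    have h2 : ‖a - b‖ ^ p ≤ 2 ^ p := by
      refine Real.rpow_le_rpow (norm_nonneg _) ?_ hp0.le
      linarith [norm_sub_le a b, (hle1 hab).1, (hle1 hab).2]
    have h3 := mul_le_mul_of_nonneg_left h1 hK
    rw [div_mul_cancel₀ _ hc.ne'] at h3
    linarith
  · have := mul_le_mul_of_nonneg_left hgap hK
    linarith [not_le.1 h]

/-- Almost-minimizers of a uniformly convex functional over decreasing midpoint-convex sets form a
Cauchy sequence. -/
lemma exists_cauchy_almost_minimizers {α : Type*} (S : ℕ → Set α) (hS : Antitone S) (J : α → ℝ)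
    (hJ0 : ∀ a, 0 ≤ J a) {G : ℝ} (hSG : ∀ N, ∃ a ∈ S N, J a ≤ G) (ρ : α → α → ℝ)
    (hmid : ∀ η : ℝ, 0 < η → ∃ K : ℝ, 0 ≤ K ∧ ∀ N, ∀ a ∈ S N, ∀ b ∈ S N, ∃ c ∈ S N,
      ρ a b + K * J c ≤ (η + K / 2) * (J a + J b)) :
    ∃ ψ : ℕ → α, (∀ N, ψ N ∈ S N) ∧
      ∀ δ : ℝ, 0 < δ → ∃ N₀, ∀ N ≥ N₀, ∀ M ≥ N, ρ (ψ N) (ψ M) ≤ δ := by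
  set m : ℕ → ℝ := fun N => sInf (J '' S N) with hm
  have hbdd : ∀ N, BddBelow (J '' S N) := fun N => ⟨0, by rintro _ ⟨a, -, rfl⟩; exact hJ0 a⟩
  have hne : ∀ N, (J '' S N).Nonempty := fun N => by
    obtain ⟨a, ha, -⟩ := hSG N
    exact ⟨_, a, ha, rfl⟩
  have hmle : ∀ {N a}, a ∈ S N → m N ≤ J a := fun ha => csInf_le (hbdd _) ⟨_, ha, rfl⟩
  have hmono : Monotone m := fun N M h => csInf_le_csInf (hbdd N) (hne M) (Set.image_mono (hS h))
  have hmG : ∀ N, m N ≤ G := fun N => by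
    obtain ⟨a, ha, haG⟩ := hSG N
    exact (hmle ha).trans haG
  have hm0 : ∀ N, 0 ≤ m N := fun N => le_csInf (hne N) (by rintro _ ⟨a, -, rfl⟩; exact hJ0 a)
  have hex : ∀ N : ℕ, ∃ a ∈ S N, J a < m N + 1 / ((N : ℝ) + 1) := fun N => by
    obtain ⟨_, ⟨a, ha, rfl⟩, h⟩ := exists_lt_of_csInf_lt (hne N)
      (lt_add_of_pos_right (m N) (by positivity : (0 : ℝ) < 1 / ((N : ℝ) + 1)))
    exact ⟨a, ha, h⟩
  choose ψ hψ hψJ using hex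
  refine ⟨ψ, hψ, fun δ hδ => ?_⟩
  set l : ℝ := ⨆ N, m N with hl
  have hbddm : BddAbove (Set.range m) := ⟨G, by rintro _ ⟨N, rfl⟩; exact hmG N⟩
  have hlim : Tendsto m atTop (𝓝 l) := tendsto_atTop_ciSup hmono hbddm
  have hml : ∀ N, m N ≤ l := le_ciSup hbddm
  have hl0 : 0 ≤ l := (hm0 0).trans (hml 0)
  set η : ℝ := δ / (4 * (l + 1)) with hη
  have hη0 : 0 < η := by positivity
  obtain ⟨K, hK, hKmid⟩ := hmid η hη0
  have hlim2 : Tendsto (fun N : ℕ => K * (l + 1 / ((N : ℝ) + 1) - m N)) atTop (𝓝 0) := by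
    have h1 := ((tendsto_const_nhds (x := l)).add
      (tendsto_one_div_add_atTop_nhds_zero_nat (𝕜 := ℝ))).sub hlim
    simpa using h1.const_mul K
  obtain ⟨N₀, hN₀⟩ := eventually_atTop.1 (hlim2.eventually_le_const (by positivity : 0 < δ / 2))
  refine ⟨N₀, fun N hN M hM => ?_⟩
  obtain ⟨c, hc, hcmid⟩ := hKmid N (ψ N) (hψ N) (ψ M) (hS hM (hψ M))
  have hinv : 1 / ((M : ℝ) + 1) ≤ 1 / ((N : ℝ) + 1) := by
    have : (N : ℝ) ≤ M := by exact_mod_cast hM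
    gcongr
  set e : ℝ := 1 / ((N : ℝ) + 1) with he
  have he1 : e ≤ 1 := by
    rw [he, div_le_one (by positivity)]
    linarith [(Nat.cast_nonneg N : (0 : ℝ) ≤ N)]
  have h1 : J (ψ N) ≤ l + e := by linarith [hψJ N, hml N]
  have h2 : J (ψ M) ≤ l + e := by linarith [hψJ M, hml M]
  have h3 : (η + K / 2) * (J (ψ N) + J (ψ M)) ≤ (η + K / 2) * (2 * (l + e)) :=
    mul_le_mul_of_nonneg_left (by linarith) (by positivity)
  have h4 : K * m N ≤ K * J c := mul_le_mul_of_nonneg_left (hmle hc) hK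
  have h5 : η * (2 * (l + e)) ≤ δ / 2 := by
    calc η * (2 * (l + e)) ≤ η * (2 * (l + 1)) := by gcongr
      _ = δ / 2 := by rw [hη]; field_simp; ring
  have h6 := hN₀ N hN
  nlinarith

/-! ### The closure of test functions in `W^{1,p}` -/

/-- Smooth functions with compact support in `Ω`. -/
def testFunctions (Ω : Set (Space d)) : Set (Space d → Space d) :=
  {ψ | ContDiff ℝ ∞ ψ ∧ HasCompactSupport ψ ∧ tsupport ψ ⊆ Ω}

lemma half_smul_add_mem_testFunctions {Ω : Set (Space d)} {a b : Space d → Space d}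
    (ha : a ∈ testFunctions Ω) (hb : b ∈ testFunctions Ω) :
    (1 / 2 : ℝ) • (a + b) ∈ testFunctions Ω := by
  refine ⟨contDiff_const.smul (ha.1.add hb.1), (ha.2.1.add hb.2.1).smul_left, ?_⟩
  refine (tsupport_smul_subset_right (fun _ => (1 / 2 : ℝ)) (a + b)).trans ?_
  exact (tsupport_add a b).trans (Set.union_subset ha.2.2 hb.2.2)

lemma tendsto_integral_smul_of_tendsto_eLpNorm {α F : Type*} [MeasurableSpace α]
    [NormedAddCommGroup F] [NormedSpace ℝ F] {μ : Measure α} [IsFiniteMeasure μ] {q : ℝ≥0∞}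
    (hq : 1 ≤ q) {χ : α → ℝ} (hχ : AEStronglyMeasurable χ μ) {M : ℝ} (hM : ∀ x, ‖χ x‖ ≤ M)
    {f : ℕ → α → F} {f' : α → F} (hf : ∀ n, MemLp (f n) q μ) (hf' : MemLp f' q μ)
    (h : Tendsto (fun n => eLpNorm (f n - f') q μ) atTop (𝓝 0)) :
    Tendsto (fun n => ∫ x, χ x • f n x ∂μ) atTop (𝓝 (∫ x, χ x • f' x ∂μ)) := by
  refine tendsto_integral_of_L1' _ (hχ.smul hf'.1) (Eventually.of_forall fun n => ?_) ?_
  · exact ((hf n).integrable hq).bdd_smul M hχ (Eventually.of_forall hM)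
  · set C : ℝ≥0∞ := μ Set.univ ^ (1 / (1 : ℝ≥0∞).toReal - 1 / q.toReal) with hC
    have hCtop : C ≠ ⊤ := by
      refine ENNReal.rpow_ne_top_of_nonneg ?_ (measure_ne_top μ _)
      rw [ENNReal.toReal_one, div_one, sub_nonneg]
      rcases eq_or_ne q ⊤ with rfl | hqt
      · simp
      · have : 1 ≤ q.toReal := by
          have := ENNReal.toReal_mono hqt hq
          simpa using this
        rw [div_le_one (by linarith)]
        exact this
    have hbound : ∀ n, eLpNorm ((fun x => χ x • f n x) - fun x => χ x • f' x) 1 μ ≤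
        ENNReal.ofReal M * (eLpNorm (f n - f') q μ * C) := by
      intro n
      refine (eLpNorm_le_mul_eLpNorm_of_ae_le_mul (g := f n - f') (c := M)
        (Eventually.of_forall fun x => ?_) 1).trans ?_
      · rw [Pi.sub_apply, ← smul_sub, norm_smul]
        exact mul_le_mul_of_nonneg_right (hM x) (norm_nonneg _)
      · gcongr
        exact eLpNorm_le_eLpNorm_mul_rpow_measure_univ hq ((hf n).sub hf').1
    have hlim : Tendsto (fun n => ENNReal.ofReal M * (eLpNorm (f n - f') q μ * C)) atTop (𝓝 0) := by
      have h1 := ENNReal.Tendsto.mul_const h (Or.inr hCtop)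
      rw [zero_mul] at h1
      have h2 := ENNReal.Tendsto.const_mul h1 (Or.inr (ENNReal.ofReal_ne_top (r := M)))
      rwa [mul_zero] at h2
    exact tendsto_of_tendsto_of_tendsto_of_le_of_le tendsto_const_nhds hlim (fun _ => zero_le)
      hbound

/-- The classical gradient of a test function is its weak gradient. -/
lemma hasWeakGradient_of_mem_testFunctions {Ω : Set (Space d)} {ψ : Space d → Space d}
    (hψ : ψ ∈ testFunctions Ω) : HasWeakGradient Ω ψ (fderiv ℝ ψ) := by
  intro φ hφ hφc hφs w
  have hφd : Continuous fun x => fderiv ℝ φ x w :=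
    (hφ.continuous_fderiv (by simp)).clm_apply continuous_const
  have hψd : Continuous fun x => fderiv ℝ ψ x w :=
    (hψ.1.continuous_fderiv (by simp)).clm_apply continuous_const
  rw [setIntegral_eq_integral_of_forall_compl_eq_zero,
    setIntegral_eq_integral_of_forall_compl_eq_zero]
  · rw [integral_smul_fderiv_eq_neg_fderiv_smul_of_integrable, neg_neg]
    · exact (hφd.smul hψ.1.continuous).integrable_of_hasCompactSupport hψ.2.1.smul_left
    · exact (hφ.continuous.smul hψd).integrable_of_hasCompactSupport hφc.smul_right
    · exact (hφ.continuous.smul hψ.1.continuous).integrable_of_hasCompactSupport hφc.smul_right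
    · exact fun x _ => (hφ.differentiable (by simp)) x
    · exact fun x _ => (hψ.1.differentiable (by simp)) x
  · intro x hx
    rw [image_eq_zero_of_notMem_tsupport fun h => hx (hφs h), zero_smul]
  · intro x hx
    rw [image_eq_zero_of_notMem_tsupport fun h => hx (hψ.2.2 h), smul_zero]

/-- Weak gradients pass to `L^p` limits. -/
lemma HasWeakGradient.of_tendsto {Ω : Set (Space d)} (hΩb : Bornology.IsBounded Ω) {q : ℝ≥0∞}
    (hq : 1 ≤ q) {f : ℕ → Space d → Space d} {Df : ℕ → Space d → Space d →L[ℝ] Space d}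
    {u : Space d → Space d} {Du : Space d → Space d →L[ℝ] Space d}
    (hfDf : ∀ n, HasWeakGradient Ω (f n) (Df n))
    (hf : ∀ n, MemLp (f n) q (volume.restrict Ω)) (hu : MemLp u q (volume.restrict Ω))
    (hDf : ∀ n, MemLp (Df n) q (volume.restrict Ω)) (hDu : MemLp Du q (volume.restrict Ω))
    (hfu : Tendsto (fun n => eLpNorm (f n - u) q (volume.restrict Ω)) atTop (𝓝 0))
    (hDfu : Tendsto (fun n => eLpNorm (Df n - Du) q (volume.restrict Ω)) atTop (𝓝 0)) :
    HasWeakGradient Ω u Du := by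
  have : IsFiniteMeasure (volume.restrict Ω) := ⟨by simpa using hΩb.measure_lt_top⟩
  intro φ hφ hφc hφs w
  have hφd : Continuous fun x => fderiv ℝ φ x w :=
    (hφ.continuous_fderiv (by simp)).clm_apply continuous_const
  obtain ⟨M₁, hM₁⟩ := hφc.exists_bound_of_continuous hφ.continuous
  obtain ⟨M₂, hM₂⟩ := (hφc.fderiv_apply (𝕜 := ℝ) w).exists_bound_of_continuous hφd
  have h1 := tendsto_integral_smul_of_tendsto_eLpNorm hq hφd.aestronglyMeasurable hM₂ hf hu hfu
  have hev : ∀ {D : Space d → Space d →L[ℝ] Space d}, MemLp D q (volume.restrict Ω) →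
      MemLp (fun x => D x w) q (volume.restrict Ω) := fun hD =>
    (ContinuousLinearMap.apply ℝ (Space d) w).comp_memLp' hD
  have h2 : Tendsto (fun n => eLpNorm ((fun x => Df n x w) - fun x => Du x w) q
      (volume.restrict Ω)) atTop (𝓝 0) := by
    have h3 := ENNReal.Tendsto.const_mul hDfu (Or.inr (ENNReal.ofReal_ne_top (r := ‖w‖)))
    rw [mul_zero] at h3
    refine tendsto_of_tendsto_of_tendsto_of_le_of_le tendsto_const_nhds h3 (fun _ => zero_le)
      fun n => eLpNorm_le_mul_eLpNorm_of_ae_le_mul (Eventually.of_forall fun x => ?_) q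
    rw [mul_comm]
    exact (Df n x - Du x).le_opNorm w
  have h4 := tendsto_integral_smul_of_tendsto_eLpNorm hq hφ.continuous.aestronglyMeasurable hM₁
    (fun n => hev (hDf n)) (hev hDu) h2
  refine tendsto_nhds_unique h1 (h4.neg.congr fun n => ?_)
  exact (hfDf n φ hφ hφc hφs w).symm

/-- **Closedness of `W_0^{1,p}` under bounded convergence.** If test functions with bounded
gradients converge in `L^p`, the limit belongs to `W_0^{1,p}`: among the test functions that are
close to the limit, almost-minimizers of the gradient energy have strongly converging gradients. -/
lemma memW1pZero_of_tendsto {p : ℝ} (hp : 1 < p) {Ω : Set (Space d)}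
    (hΩb : Bornology.IsBounded Ω) {f : ℕ → Space d → Space d} (hf : ∀ n, f n ∈ testFunctions Ω)
    {w : Space d → Space d} (hw : MemLp w (ENNReal.ofReal p) (volume.restrict Ω))
    (hfw : Tendsto (fun n => eLpNorm (f n - w) (ENNReal.ofReal p) (volume.restrict Ω)) atTop (𝓝 0))
    {G : ℝ≥0∞} (hG : G ≠ ⊤) (hfG : ∀ n, ∫⁻ x, ‖fderiv ℝ (f n) x‖ₑ ^ p ≤ G) :
    MemW1pZero w (ENNReal.ofReal p) Ω := by
  have hp0 : 0 < p := by linarith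
  have hq : (1 : ℝ≥0∞) ≤ ENNReal.ofReal p := by simpa using hp.le
  have : Fact ((1 : ℝ≥0∞) ≤ ENNReal.ofReal p) := ⟨hq⟩
  set q := ENNReal.ofReal p with hqdef
  set μ := (volume : Measure (Space d)).restrict Ω with hμ
  -- the operator norm is not strictly convex, so gradients are moved to a Euclidean space
  obtain ⟨m, ⟨T⟩⟩ : ∃ m : ℕ, Nonempty ((Space d →L[ℝ] Space d) ≃L[ℝ] Space m) :=
    ⟨_, ⟨toEuclidean⟩⟩
  set T₁ : (Space d →L[ℝ] Space d) →L[ℝ] Space m := T.toContinuousLinearMap with hT₁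
  set T₂ : Space m →L[ℝ] (Space d →L[ℝ] Space d) := T.symm.toContinuousLinearMap with hT₂
  have hgc : ∀ {a}, a ∈ testFunctions Ω → Continuous (fderiv ℝ a) := fun ha =>
    ha.1.continuous_fderiv (by simp)
  have hTmem : ∀ {a}, a ∈ testFunctions Ω → MemLp (fun x => T₁ (fderiv ℝ a x)) q μ := by
    intro a ha
    refine MemLp.restrict Ω ?_
    exact (T₁.continuous.comp (hgc ha)).memLp_of_hasCompactSupport
      ((ha.2.1.fderiv (𝕜 := ℝ)).comp_left (map_zero T₁))
  have hmem : ∀ {a}, a ∈ testFunctions Ω → MemLp a q μ := fun ha =>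
    MemLp.restrict Ω (ha.1.continuous.memLp_of_hasCompactSupport ha.2.1)
  have hint : ∀ {F : Space d → Space m},
      MemLp F q μ → Integrable (fun x => ‖F x‖ ^ p) μ := by
    intro F hF
    have := hF.integrable_norm_rpow (by simpa [hqdef] using hp0) ENNReal.ofReal_ne_top
    rwa [hqdef, ENNReal.toReal_ofReal hp0.le] at this
  have hlint : ∀ {F : Space d → Space m},
      MemLp F q μ → ∫⁻ x, ‖F x‖ₑ ^ p ∂μ = ENNReal.ofReal (∫ x, ‖F x‖ ^ p ∂μ) := by
    intro F hF
    rw [ofReal_integral_eq_lintegral_ofReal (hint hF) (Eventually.of_forall fun x => by positivity)]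
    refine lintegral_congr fun x => ?_
    rw [← ofReal_norm, ENNReal.ofReal_rpow_of_nonneg (norm_nonneg _) hp0.le]
  set S : ℕ → Set (Space d → Space d) := fun N =>
    {a | a ∈ testFunctions Ω ∧ eLpNorm (a - w) q μ ≤ ENNReal.ofReal (1 / ((N : ℝ) + 1))} with hS
  set J : (Space d → Space d) → ℝ := fun a => ∫ x, ‖T₁ (fderiv ℝ a x)‖ ^ p ∂μ with hJ
  set ρ : (Space d → Space d) → (Space d → Space d) → ℝ := fun a b =>
    ∫ x, ‖T₁ (fderiv ℝ a x) - T₁ (fderiv ℝ b x)‖ ^ p ∂μ with hρ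
  have hSanti : Antitone S := by
    intro N M h a ha
    refine ⟨ha.1, ha.2.trans (ENNReal.ofReal_le_ofReal ?_)⟩
    have : (N : ℝ) ≤ M := by exact_mod_cast h
    gcongr
  have hSG : ∀ N, ∃ a ∈ S N, J a ≤ (‖T₁‖ₑ ^ p * G).toReal := by
    intro N
    have hpos : (0 : ℝ≥0∞) < ENNReal.ofReal (1 / ((N : ℝ) + 1)) := by
      rw [ENNReal.ofReal_pos]
      positivity
    obtain ⟨n, hn⟩ := (hfw.eventually_le_const hpos).exists
    refine ⟨f n, ⟨hf n, hn⟩, ?_⟩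
    refine (ENNReal.ofReal_le_iff_le_toReal (ENNReal.mul_ne_top (by finiteness) hG)).1 ?_
    rw [← hlint (hTmem (hf n))]
    calc ∫⁻ x, ‖T₁ (fderiv ℝ (f n) x)‖ₑ ^ p ∂μ ≤ ∫⁻ x, ‖T₁ (fderiv ℝ (f n) x)‖ₑ ^ p :=
          lintegral_mono' Measure.restrict_le_self le_rfl
      _ ≤ ∫⁻ x, ‖T₁‖ₑ ^ p * ‖fderiv ℝ (f n) x‖ₑ ^ p := by
          refine lintegral_mono fun x => ?_
          rw [← ENNReal.mul_rpow_of_nonneg _ _ hp0.le]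
          gcongr
          exact T₁.le_opENorm _
      _ ≤ _ := by
          rw [lintegral_const_mul _ ((hgc (hf n)).enorm.measurable.pow_const p)]
          gcongr
          exact hfG n
  have hmid : ∀ η : ℝ, 0 < η → ∃ K : ℝ, 0 ≤ K ∧ ∀ N, ∀ a ∈ S N, ∀ b ∈ S N, ∃ c ∈ S N,
      ρ a b + K * J c ≤ (η + K / 2) * (J a + J b) := by
    intro η hη
    obtain ⟨K, hK, hKab⟩ := exists_midpoint_const
      (E := Space m) hp hη
    refine ⟨K, hK, fun N a ha b hb => ⟨(1 / 2 : ℝ) • (a + b),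
      ⟨half_smul_add_mem_testFunctions ha.1 hb.1, ?_⟩, ?_⟩⟩
    · have h1 : (1 / 2 : ℝ) • (a + b) - w = (1 / 2 : ℝ) • ((a - w) + (b - w)) := by
        funext x
        simp only [Pi.sub_apply, Pi.smul_apply, Pi.add_apply]
        module
      have h2 : ‖(1 / 2 : ℝ)‖ₑ = 2⁻¹ := by
        rw [← ofReal_norm, Real.norm_of_nonneg (by norm_num), one_div,
          ENNReal.ofReal_inv_of_pos (by norm_num)]
        simp
      rw [h1, eLpNorm_const_smul, h2]
      calc 2⁻¹ * eLpNorm (a - w + (b - w)) q μ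
          ≤ 2⁻¹ * (ENNReal.ofReal (1 / ((N : ℝ) + 1)) + ENNReal.ofReal (1 / ((N : ℝ) + 1))) := by
            gcongr
            exact (eLpNorm_add_le ((hmem ha.1).sub hw).1 ((hmem hb.1).sub hw).1 hq).trans
              (add_le_add ha.2 hb.2)
        _ = _ := by
            rw [← two_mul, ← mul_assoc, ENNReal.inv_mul_cancel (by simp) (by simp), one_mul]
    · have hcder : ∀ x, T₁ (fderiv ℝ ((1 / 2 : ℝ) • (a + b)) x) =
          (1 / 2 : ℝ) • (T₁ (fderiv ℝ a x) + T₁ (fderiv ℝ b x)) := by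
        intro x
        have hda : DifferentiableAt ℝ a x := (ha.1.1.differentiable (by simp)) x
        have hdb : DifferentiableAt ℝ b x := (hb.1.1.differentiable (by simp)) x
        rw [fderiv_const_smul (hda.add hdb), fderiv_add hda hdb, map_smul, map_add]
      have hia := hint (hTmem ha.1)
      have hib := hint (hTmem hb.1)
      have hiab := hint ((hTmem ha.1).sub (hTmem hb.1))
      have hic := hint (((hTmem ha.1).add (hTmem hb.1)).const_smul (1 / 2 : ℝ))
      simp only [hρ, hJ, hcder]
      rw [← integral_const_mul, ← integral_add hia hib, ← integral_const_mul]
      refine (integral_add hiab (hic.const_mul K)).symm.trans_le ?_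
      exact integral_mono (hiab.add (hic.const_mul K)) ((hia.add hib).const_mul _)
        fun x => hKab _ _
  obtain ⟨ψ, hψS, hψC⟩ := exists_cauchy_almost_minimizers S hSanti J
    (fun a => integral_nonneg fun x => by positivity) hSG ρ hmid
  have hψ : ∀ N, ψ N ∈ testFunctions Ω := fun N => (hψS N).1
  set H : ℕ → Lp (Space m) q μ :=
    fun N => (hTmem (hψ N)).toLp _ with hH
  have hcauchy : CauchySeq H := by
    refine EMetric.cauchySeq_iff'.2 fun e he => ?_
    obtain ⟨c, hc0, hce⟩ := ENNReal.lt_iff_exists_nnreal_btwn.1 he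
    have hcpos : (0 : ℝ) < c := by exact_mod_cast hc0
    obtain ⟨N₀, hN₀⟩ := hψC ((c : ℝ) ^ p) (by positivity)
    refine ⟨N₀, fun n hn => ?_⟩
    rw [edist_comm, hH, Lp.edist_toLp_toLp]
    refine lt_of_le_of_lt (eLpNorm_le_of_lintegral_le hp ?_) hce
    rw [hlint ((hTmem (hψ N₀)).sub (hTmem (hψ n)))]
    refine (ENNReal.ofReal_le_ofReal (hN₀ N₀ le_rfl n hn)).trans ?_
    rw [← ENNReal.ofReal_rpow_of_nonneg hcpos.le hp0.le, ENNReal.ofReal_coe_nnreal]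
  obtain ⟨L, hL⟩ := cauchySeq_tendsto_of_complete hcauchy
  have hLψ : Tendsto (fun N =>
      eLpNorm ((fun x => T₁ (fderiv ℝ (ψ N) x)) - (L : Space d → Space m)) q μ)
      atTop (𝓝 0) := by
    refine ((Lp.tendsto_Lp_iff_tendsto_eLpNorm' _ _).1 hL).congr fun N => eLpNorm_congr_ae ?_
    exact (MemLp.coeFn_toLp (hTmem (hψ N))).sub (ae_eq_refl _)
  have hDu : MemLp (fun x => T₂ (L x)) q μ := T₂.comp_memLp' (Lp.memLp L)
  have hDlim : Tendsto (fun N => eLpNorm (fderiv ℝ (ψ N) - fun x => T₂ (L x)) q μ)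
      atTop (𝓝 0) := by
    have h1 := ENNReal.Tendsto.const_mul hLψ (Or.inr (ENNReal.ofReal_ne_top (r := ‖T₂‖)))
    rw [mul_zero] at h1
    refine tendsto_of_tendsto_of_tendsto_of_le_of_le tendsto_const_nhds h1 (fun _ => zero_le)
      fun N => eLpNorm_le_mul_eLpNorm_of_ae_le_mul (Eventually.of_forall fun x => ?_) q
    have h2 : (fderiv ℝ (ψ N) - fun x => T₂ (L x)) x =
        T₂ (T₁ (fderiv ℝ (ψ N) x) - L x) := by
      simp [hT₁, hT₂]
    rw [h2]
    exact T₂.le_opNorm _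
  have hψlim : Tendsto (fun N => eLpNorm (ψ N - w) q μ) atTop (𝓝 0) := by
    have h1 : Tendsto (fun N : ℕ => ENNReal.ofReal (1 / ((N : ℝ) + 1))) atTop (𝓝 0) := by
      simpa using ENNReal.tendsto_ofReal (tendsto_one_div_add_atTop_nhds_zero_nat (𝕜 := ℝ))
    exact tendsto_of_tendsto_of_tendsto_of_le_of_le tendsto_const_nhds h1 (fun _ => zero_le)
      fun N => (hψS N).2
  refine ⟨hw, _, hDu, ?_, ψ, hψ, hψlim, hDlim⟩
  exact HasWeakGradient.of_tendsto hΩb hq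
    (fun N => hasWeakGradient_of_mem_testFunctions (hψ N)) (fun N => hmem (hψ N)) hw
    (fun N => MemLp.restrict Ω ((hgc (hψ N)).memLp_of_hasCompactSupport
      ((hψ N).2.1.fderiv (𝕜 := ℝ)))) hDu hψlim hDlim

/-! ### Elementary properties of Sobolev functions -/

/-- A continuous function in `W^{1,∞}(ℝ^d)` is Lipschitz: its mollifications are, with the
essential supremum of the weak gradient as Lipschitz constant. -/
lemma MemW1p.exists_lipschitz_const {g : Space d → Space d} (hg : MemW1p g ⊤ Set.univ)
    (hgc : Continuous g) : ∃ L : ℝ, 0 ≤ L ∧ ∀ x z, ‖g x - g z‖ ≤ L * ‖x - z‖ := by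
  obtain ⟨-, Dg, hDg, hweak⟩ := hg
  simp only [Measure.restrict_univ] at hDg
  set L : ℝ := (eLpNorm Dg ⊤ volume).toReal with hL
  have hbound : ∀ᵐ x ∂(volume : Measure (Space d)), ‖Dg x‖ ≤ L := by
    filter_upwards [enorm_ae_le_eLpNormEssSup Dg volume] with x hx
    rw [hL, eLpNorm_exponent_top, ← toReal_enorm]
    refine ENNReal.toReal_mono ?_ hx
    rw [← eLpNorm_exponent_top]
    exact hDg.2.ne
  have hL0 : 0 ≤ L := ENNReal.toReal_nonneg
  refine ⟨L, hL0, ?_⟩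
  set Λ := (ContinuousLinearMap.lsmul ℝ ℝ : ℝ →L[ℝ] Space d →L[ℝ] Space d) with hΛ
  set b : ℕ → ContDiffBump (0 : Space d) := fun n =>
    ⟨1 / ((n : ℝ) + 1) / 2, 1 / ((n : ℝ) + 1), by positivity, half_lt_self (by positivity)⟩ with hb
  set η : ℕ → Space d → ℝ := fun n => (b n).normed volume with hη
  have hηs : ∀ n, ContDiff ℝ ∞ (η n) := fun n => (b n).contDiff_normed
  have hηc : ∀ n, HasCompactSupport (η n) := fun n => (b n).hasCompactSupport_normed
  set u : ℕ → Space d → Space d := fun n => convolution g (η n) Λ.flip volume with hu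
  have hder : ∀ n x, HasFDerivAt (u n)
      (convolution g (fderiv ℝ (η n)) (Λ.flip.precompR (Space d)) volume x) x := fun n x =>
    (hηc n).hasFDerivAt_convolution_right Λ.flip hgc.locallyIntegrable
      ((hηs n).of_le (by simp)) x
  have hdb : ∀ n x,
      ‖convolution g (fderiv ℝ (η n)) (Λ.flip.precompR (Space d)) volume x‖ ≤ L := by
    intro n x
    refine ContinuousLinearMap.opNorm_le_bound _ hL0 fun w => ?_
    rw [convolution_precompR_apply Λ.flip hgc.locallyIntegrable ((hηc n).fderiv (𝕜 := ℝ))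
      ((hηs n).continuous_fderiv (by simp)), convolution_def]
    -- the reflected mollifier is a test function for the weak gradient
    set φ : Space d → ℝ := fun t => η n (x - t) with hφ
    have hφs : ContDiff ℝ ∞ φ := (hηs n).comp (contDiff_const.sub contDiff_id)
    have hφc : HasCompactSupport φ := (hηc n).comp_homeomorph (Homeomorph.subLeft x)
    have hφd : ∀ t, fderiv ℝ φ t w = -fderiv ℝ (η n) (x - t) w := by
      intro t
      have h1 : HasFDerivAt (fun t : Space d => x - t)
          (-(ContinuousLinearMap.id ℝ (Space d))) t := (hasFDerivAt_id t).const_sub x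
      have h2 := (((hηs n).differentiable (by simp)) (x - t)).hasFDerivAt.comp t h1
      have h3 : fderiv ℝ φ t = _ := h2.fderiv
      rw [h3]
      simp
    have h1 := hweak φ hφs hφc (Set.subset_univ _) w
    simp only [Measure.restrict_univ, hφd, neg_smul, integral_neg, neg_inj] at h1
    have h2 : ∫ t, Λ.flip (g t) (fderiv ℝ (η n) (x - t) w) = ∫ t, φ t • Dg t w := h1
    rw [h2]
    have hint : Integrable φ volume := hφs.continuous.integrable_of_hasCompactSupport hφc
    have hφ1 : ∫ t, φ t = 1 := by
      rw [hφ, integral_sub_left_eq_self (η n) volume x]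
      exact (b n).integral_normed
    calc ‖∫ t, φ t • Dg t w‖ ≤ ∫ t, φ t * (L * ‖w‖) := by
          refine norm_integral_le_of_norm_le (hint.mul_const _) ?_
          filter_upwards [hbound] with t ht
          have hφ0 : 0 ≤ φ t := (b n).nonneg_normed _
          rw [norm_smul, Real.norm_of_nonneg hφ0]
          gcongr
          exact ((Dg t).le_opNorm w).trans (by gcongr)
      _ = L * ‖w‖ := by rw [integral_mul_const, hφ1, one_mul]
  have hlip : ∀ n x z, ‖u n x - u n z‖ ≤ L * ‖x - z‖ := fun n x z =>
    convex_univ.norm_image_sub_le_of_norm_hasFDerivWithin_le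
      (fun y _ => (hder n y).hasFDerivWithinAt) (fun y _ => hdb n y) (Set.mem_univ z)
      (Set.mem_univ x)
  have hlim : ∀ x, Tendsto (fun n => u n x) atTop (𝓝 (g x)) := by
    intro x
    have h1 : Tendsto (fun n => (b n).rOut) atTop (𝓝 0) :=
      tendsto_one_div_add_atTop_nhds_zero_nat (𝕜 := ℝ)
    have h2 := ContDiffBump.convolution_tendsto_right_of_continuous (μ := volume) h1 hgc x
    refine h2.congr fun n => ?_
    rw [hu, ← convolution_flip]
  intro x z
  exact le_of_tendsto ((hlim x).sub (hlim z)).norm (Eventually.of_forall fun n => hlip n x z)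

lemma HasWeakGradient.mono {Ω : Set (Space d)} {u : Space d → Space d}
    {Du : Space d → Space d →L[ℝ] Space d} (h : HasWeakGradient Set.univ u Du) :
    HasWeakGradient Ω u Du := by
  intro φ hφ hφc hφs w
  have h1 := h φ hφ hφc (Set.subset_univ _) w
  rw [Measure.restrict_univ] at h1
  rw [setIntegral_eq_integral_of_forall_compl_eq_zero,
    setIntegral_eq_integral_of_forall_compl_eq_zero, h1]
  · intro x hx
    rw [image_eq_zero_of_notMem_tsupport fun h => hx (hφs h), zero_smul]
  · intro x hx
    rw [image_eq_zero_of_notMem_tsupport (f := fderiv ℝ φ)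
      fun h => hx (hφs (tsupport_fderiv_subset ℝ h))]
    simp

lemma MemW1p.mono_exponent_of_isBounded {Ω : Set (Space d)} (hΩ : Bornology.IsBounded Ω)
    {u : Space d → Space d} (hu : MemW1p u ⊤ Set.univ) (q : ℝ≥0∞) : MemW1p u q Ω := by
  have : IsFiniteMeasure (volume.restrict Ω) := ⟨by simpa using hΩ.measure_lt_top⟩
  obtain ⟨h1, Du, h2, h3⟩ := hu
  rw [Measure.restrict_univ] at h1 h2
  exact ⟨(h1.restrict Ω).mono_exponent le_top, Du, (h2.restrict Ω).mono_exponent le_top, h3.mono⟩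

lemma memLp_add_of_normedAddCommGroup {α F : Type*} [MeasurableSpace α] {μ : Measure α}
    [NormedAddCommGroup F] {q : ℝ≥0∞} {f g : α → F} (hf : MemLp f q μ) (hg : MemLp g q μ) :
    MemLp (f + g) q μ :=
  hf.add hg

lemma MemW1p.add {Ω : Set (Space d)} (hΩ : Bornology.IsBounded Ω) {q : ℝ≥0∞} (hq : 1 ≤ q)
    {u₁ u₂ : Space d → Space d} (h₁ : MemW1p u₁ q Ω) (h₂ : MemW1p u₂ q Ω) :
    MemW1p (u₁ + u₂) q Ω := by
  have : IsFiniteMeasure (volume.restrict Ω) := ⟨by simpa using hΩ.measure_lt_top⟩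
  obtain ⟨hu₁, D₁, hD₁, hw₁⟩ := h₁
  obtain ⟨hu₂, D₂, hD₂, hw₂⟩ := h₂
  refine ⟨hu₁.add hu₂, D₁ + D₂, memLp_add_of_normedAddCommGroup hD₁ hD₂, fun φ hφ hφc hφs w => ?_⟩
  have hφd : Continuous fun x => fderiv ℝ φ x w :=
    (hφ.continuous_fderiv (by simp)).clm_apply continuous_const
  obtain ⟨M₁, hM₁⟩ := hφc.exists_bound_of_continuous hφ.continuous
  obtain ⟨M₂, hM₂⟩ := (hφc.fderiv_apply (𝕜 := ℝ) w).exists_bound_of_continuous hφd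
  have hi : ∀ {u : Space d → Space d}, MemLp u q (volume.restrict Ω) →
      Integrable (fun x => fderiv ℝ φ x w • u x) (volume.restrict Ω) := fun hu =>
    (hu.integrable hq).bdd_smul M₂ hφd.aestronglyMeasurable (Eventually.of_forall hM₂)
  have hj : ∀ {D : Space d → Space d →L[ℝ] Space d}, MemLp D q (volume.restrict Ω) →
      Integrable (fun x => φ x • D x w) (volume.restrict Ω) := fun hD =>
    (((ContinuousLinearMap.apply ℝ (Space d) w).comp_memLp' hD).integrable hq).bdd_smul M₁
      hφ.continuous.aestronglyMeasurable (Eventually.of_forall hM₁)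
  have e₁ : ∀ x, fderiv ℝ φ x w • (u₁ + u₂) x = fderiv ℝ φ x w • u₁ x + fderiv ℝ φ x w • u₂ x :=
    fun x => smul_add _ _ _
  have e₂ : ∀ x, φ x • (D₁ + D₂) x w = φ x • D₁ x w + φ x • D₂ x w := fun x => smul_add _ _ _
  rw [integral_congr_ae (Eventually.of_forall e₁), integral_congr_ae (Eventually.of_forall e₂),
    integral_add (hi hu₁) (hi hu₂), integral_add (hj hD₁) (hj hD₂), hw₁ φ hφ hφc hφs w,
    hw₂ φ hφ hφc hφs w, neg_add]

lemma MemW1pZero.memW1p {Ω : Set (Space d)} {q : ℝ≥0∞} {u : Space d → Space d}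
    (h : MemW1pZero u q Ω) : MemW1p u q Ω := by
  obtain ⟨h1, Du, h2, h3, -⟩ := h
  exact ⟨h1, Du, h2, h3⟩

/-! ### Cells and corners in lattice coordinates -/

/-- The coordinates with respect to the linearly independent vectors `v`. -/
lemma exists_latticeCoordinates {v : Fin d → Space d} (hv : LinearIndependent ℝ v) :
    ∃ Φ : Space d ≃L[ℝ] (Fin d → ℝ), ∀ t, Φ.symm t = applyA v t := by
  have hspan : ⊤ ≤ Submodule.span ℝ (Set.range v) :=
    (hv.span_eq_top_of_card_eq_finrank' (by simp)).ge
  refine ⟨(Module.Basis.mk hv hspan).equivFunL, fun t => ?_⟩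
  change (Module.Basis.mk hv hspan).equivFun.symm t = applyA v t
  simp [applyA, Module.Basis.equivFun_symm_apply]

/-- The center of the cell with index `n`. -/
noncomputable def cellCenter (v : Fin d → Space d) (ε : ℝ) (n : Fin d → ℤ) : Space d :=
  ε • applyA v (fun i => (n i : ℝ)) + ε • applyA v (fun _ => 1 / 2)

lemma cellCenter_mem_centers (v : Fin d → Space d) (ε : ℝ) (n : Fin d → ℤ) :
    cellCenter v ε n ∈ centers v ε :=
  ⟨n, rfl⟩

variable {v : Fin d → Space d} {Φ : Space d ≃L[ℝ] (Fin d → ℝ)}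

lemma coord_applyA (hΦ : ∀ t, Φ.symm t = applyA v t) (t : Fin d → ℝ) : Φ (applyA v t) = t := by
  rw [← hΦ, Φ.apply_symm_apply]

lemma coord_cellCenter (hΦ : ∀ t, Φ.symm t = applyA v t) (ε : ℝ) (n : Fin d → ℤ) (i : Fin d) :
    Φ (cellCenter v ε n) i = ε * (n i + 1 / 2) := by
  simp only [cellCenter, map_add, map_smul, coord_applyA hΦ, Pi.add_apply, Pi.smul_apply,
    smul_eq_mul]
  ring

lemma mem_cell_iff (hΦ : ∀ t, Φ.symm t = applyA v t) {ε : ℝ} (hε : 0 < ε) (n : Fin d → ℤ)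
    (x : Space d) : x ∈ cell v ε (cellCenter v ε n) ↔ cellIndex Φ ε x = n := by
  rw [cellIndex_eq_iff Φ hε]
  constructor
  · rintro ⟨t, ht, rfl⟩ i
    simp only [map_add, map_smul, coord_applyA hΦ, Pi.add_apply, Pi.smul_apply, smul_eq_mul,
      coord_cellCenter hΦ]
    have := ht i
    constructor <;> nlinarith
  · intro h
    refine ⟨fun i => Φ x i / ε - n i - 1 / 2, fun i => ?_, ?_⟩
    · have h1 := h i
      have h2 : (n i : ℝ) ≤ Φ x i / ε := by
        rw [le_div_iff₀ hε]
        linarith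
      have h3 : Φ x i / ε < n i + 1 := by
        rw [div_lt_iff₀ hε]
        linarith
      constructor <;> linarith
    · apply Φ.injective
      funext i
      simp only [map_add, map_smul, coord_applyA hΦ, Pi.add_apply, Pi.smul_apply, smul_eq_mul,
        coord_cellCenter hΦ]
      field_simp
      ring

lemma cellIndex_cellCenter (hΦ : ∀ t, Φ.symm t = applyA v t) {ε : ℝ} (hε : 0 < ε)
    (n : Fin d → ℤ) : cellIndex Φ ε (cellCenter v ε n) = n := by
  rw [cellIndex_eq_iff Φ hε]
  intro i
  rw [coord_cellCenter hΦ]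
  constructor <;> nlinarith

lemma cellCenter_injective (hΦ : ∀ t, Φ.symm t = applyA v t) {ε : ℝ} (hε : 0 < ε) :
    Function.Injective (cellCenter v ε) := fun n m h => by
  rw [← cellIndex_cellCenter hΦ hε n, h, cellIndex_cellCenter hΦ hε m]

/-- A corner of a cell, as the base point of a neighboring cell. -/
lemma coord_corner (hΦ : ∀ t, Φ.symm t = applyA v t) (ε : ℝ) (m : Fin d → ℤ) (s : Fin d → Bool)
    (i : Fin d) :
    Φ (cellCenter v ε m + ε • corner v s) i = ε * ((m + cornerShift s) i : ℤ) := by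
  simp only [corner, map_add, map_smul, coord_applyA hΦ, Pi.add_apply, Pi.smul_apply, smul_eq_mul,
    coord_cellCenter hΦ, cornerShift]
  cases s i <;> simp <;> ring

lemma cellIndex_corner (hΦ : ∀ t, Φ.symm t = applyA v t) {ε : ℝ} (hε : 0 < ε) (m : Fin d → ℤ)
    (s : Fin d → Bool) :
    cellIndex Φ ε (cellCenter v ε m + ε • corner v s) = m + cornerShift s := by
  rw [cellIndex_eq_iff Φ hε]
  intro i
  rw [coord_corner hΦ]
  exact ⟨le_rfl, by nlinarith⟩

/-- A corner of a cell is the lowest corner of the neighboring cell that contains it. -/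
lemma corner_eq_lowest_corner (hΦ : ∀ t, Φ.symm t = applyA v t) (ε : ℝ) (m : Fin d → ℤ)
    (s : Fin d → Bool) :
    cellCenter v ε m + ε • corner v s =
      cellCenter v ε (m + cornerShift s) + ε • corner v (fun _ => false) := by
  apply Φ.injective
  funext i
  rw [coord_corner hΦ, coord_corner hΦ]
  simp [cornerShift]

lemma corner_mem_closure_cell (v : Fin d → Space d) (ε : ℝ) (c : Space d) (s : Fin d → Bool) :
    c + ε • corner v s ∈ closure (cell v ε c) := by
  set F : (Fin d → ℝ) → Space d := fun t => c + ε • applyA v t with hF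
  have hFc : Continuous F := by
    unfold F applyA
    fun_prop
  set Q : Set (Fin d → ℝ) := Set.pi Set.univ fun _ => Set.Ico (-(1 / 2) : ℝ) (1 / 2) with hQ
  have hQcell : F '' Q ⊆ cell v ε c := by
    rintro _ ⟨t, ht, rfl⟩
    exact ⟨t, fun i => ht i trivial, rfl⟩
  refine closure_mono hQcell (image_closure_subset_closure_image hFc ⟨_, ?_, rfl⟩)
  rw [hQ, closure_pi_set]
  intro i _
  rw [closure_Ico (by norm_num)]
  by_cases h : s i = true <;> simp [h]

/-! ### The difference of a lattice deformation and the boundary datum -/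

open Classical in
/-- The lattice function `y - g`: its value at `n` is the value of `y` on the part in `Ω` of the
cell `n` minus the value of `g` at the center, and `0` if the cell does not meet `Ω`. -/
noncomputable def latticeDifference (v : Fin d → Space d) (ε : ℝ) (Ω : Set (Space d))
    (y g : Space d → Space d) (n : Fin d → ℤ) : Space d :=
  if h : (cell v ε (cellCenter v ε n) ∩ Ω).Nonempty then y h.some - g (cellCenter v ε n) else 0

variable {ε : ℝ} {Ω : Set (Space d)} {y g : Space d → Space d}

lemma latticeDifference_eq (hy : y ∈ latticeDeformations v ε Ω) {n : Fin d → ℤ} {a : Space d}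
    (ha : a ∈ cell v ε (cellCenter v ε n)) (haΩ : a ∈ Ω) :
    latticeDifference v ε Ω y g n = y a - g (cellCenter v ε n) := by
  have h : (cell v ε (cellCenter v ε n) ∩ Ω).Nonempty := ⟨a, ha, haΩ⟩
  rw [latticeDifference, dif_pos h, hy (cellCenter v ε n)
    ⟨cellCenter_mem_centers v ε n, a, subset_closure ha, haΩ⟩ _ h.some_mem a ⟨ha, haΩ⟩]

lemma latticeDifference_support_subset (hΦ : ∀ t, Φ.symm t = applyA v t) (hε : 0 < ε) :
    (latticeDifference v ε Ω y g).support ⊆ cellIndex Φ ε '' Ω := by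
  intro n hn
  by_cases h : (cell v ε (cellCenter v ε n) ∩ Ω).Nonempty
  · obtain ⟨a, ha, haΩ⟩ := h
    exact ⟨a, haΩ, (mem_cell_iff hΦ hε n a).1 ha⟩
  · exact absurd (dif_neg h) hn

/-- **Vanishing at the boundary.** If the cell `m` is not an inner cell, then a deformation with
boundary datum `g` agrees with `g` at all corners of `m`: such a corner belongs to the lattice
boundary, or lies in a cell that does not meet `Ω`. -/
lemma latticeDifference_corner_eq_zero (hΦ : ∀ t, Φ.symm t = applyA v t) (hε : 0 < ε)
    (hy : y ∈ latticeDeformationsBdry v ε Ω g) {m : Fin d → ℤ}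
    (hm : cellCenter v ε m ∉ innerCenters v ε Ω) (s : Fin d → Bool) :
    latticeDifference v ε Ω y g (m + cornerShift s) = 0 := by
  set c' := cellCenter v ε (m + cornerShift s) with hc'
  by_cases h : (cell v ε c' ∩ Ω).Nonempty
  swap
  · exact dif_neg h
  obtain ⟨a, ha, haΩ⟩ := h
  set x := cellCenter v ε m + ε • corner v s with hx
  have hxc' : x ∈ cell v ε c' := (mem_cell_iff hΦ hε _ _).2 (cellIndex_corner hΦ hε m s)
  have houter : c' ∈ outerCenters v ε Ω :=
    ⟨cellCenter_mem_centers v ε _, a, subset_closure ha, haΩ⟩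
  have hxbdry : x ∈ latticeBoundary v ε Ω := by
    by_cases hout : cellCenter v ε m ∈ outerCenters v ε Ω
    · exact ⟨_, ⟨hout, hm⟩, s, rfl⟩
    · refine ⟨c', ⟨houter, fun hin => hout ?_⟩, fun _ => false, corner_eq_lowest_corner hΦ ε m s⟩
      exact ⟨cellCenter_mem_centers v ε m, x, corner_mem_closure_cell v ε _ s,
        hin.2 (subset_closure hxc')⟩
  rw [latticeDifference_eq hy.1 ha haΩ,
    hy.2 x hxbdry c' (cellCenter_mem_centers v ε _) hxc' a ⟨ha, haΩ⟩, sub_self]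

lemma discreteGradient_mem_V0 (v : Fin d → Space d) (ε : ℝ) (y : Space d → Space d)
    (c : Space d) : discreteGradient v ε y c ∈ V0 d := by
  change ∑ s : Fin d → Bool, ε⁻¹ • (y (c + ε • corner v s) - cornerAverage v ε y c) = 0
  rw [← Finset.smul_sum, Finset.sum_sub_distrib, Finset.sum_const, cornerAverage,
    Finset.card_univ, Fintype.card_fun, Fintype.card_bool, Fintype.card_fin,
    ← Nat.cast_smul_eq_nsmul ℝ,
    smul_smul, Nat.cast_pow, Nat.cast_ofNat, mul_inv_cancel₀ (by positivity), one_smul, sub_self,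
    smul_zero]

/-- On an inner cell, the corner oscillation of `y - g` is controlled by the discrete gradient. -/
lemma cornerOsc_latticeDifference_le (hΦ : ∀ t, Φ.symm t = applyA v t) (hε : 0 < ε)
    (hy : y ∈ latticeDeformations v ε Ω) {L : ℝ} (hL : ∀ x z, ‖g x - g z‖ ≤ L * ‖x - z‖)
    {m : Fin d → ℤ} (hm : cellCenter v ε m ∈ innerCenters v ε Ω) :
    cornerOsc (latticeDifference v ε Ω y g) m / ε ≤
      2 ^ d * 2 * ‖discreteGradient v ε y (cellCenter v ε m)‖ +
        ∑ s : Fin d → Bool, L * ‖applyA v (fun i => (cornerShift s i : ℝ))‖ := by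
  set c := cellCenter v ε m with hc
  set F := discreteGradient v ε y c with hF
  have hFs : ∀ s, y (c + ε • corner v s) = ε • F s + cornerAverage v ε y c := by
    intro s
    change _ = ε • ε⁻¹ • (y (c + ε • corner v s) - cornerAverage v ε y c) + _
    rw [smul_inv_smul₀ hε.ne', sub_add_cancel]
  have hval : ∀ s, latticeDifference v ε Ω y g (m + cornerShift s) =
      y (c + ε • corner v s) - g (cellCenter v ε (m + cornerShift s)) := fun s =>
    latticeDifference_eq hy ((mem_cell_iff hΦ hε _ _).2 (cellIndex_corner hΦ hε m s))
      (hm.2 (corner_mem_closure_cell v ε _ s))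
  have hzero : cornerShift (fun _ : Fin d => false) = 0 := by
    funext i
    simp [cornerShift]
  have hval0 := hval fun _ => false
  rw [hzero, add_zero] at hval0
  have hshift : ∀ s, cellCenter v ε (m + cornerShift s) - c =
      ε • applyA v (fun i => (cornerShift s i : ℝ)) := by
    intro s
    apply Φ.injective
    funext i
    simp only [hc, map_sub, map_smul, coord_applyA hΦ, Pi.sub_apply, Pi.smul_apply, smul_eq_mul,
      coord_cellCenter hΦ, Pi.add_apply, Int.cast_add]
    ring
  have hterm : ∀ s, ‖latticeDifference v ε Ω y g (m + cornerShift s) -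
      latticeDifference v ε Ω y g m‖ ≤
      ε * (2 * ‖F‖ + L * ‖applyA v (fun i => (cornerShift s i : ℝ))‖) := by
    intro s
    rw [hval s, hval0, hFs s, hFs]
    have h1 : ε • F s + cornerAverage v ε y c - g (cellCenter v ε (m + cornerShift s)) -
        (ε • F (fun _ => false) + cornerAverage v ε y c - g c) =
        ε • (F s - F fun _ => false) - (g (cellCenter v ε (m + cornerShift s)) - g c) := by
      module
    rw [h1]
    have h2 : ‖F s - F fun _ => false‖ ≤ 2 * ‖F‖ := by
      refine (norm_sub_le _ _).trans ?_
      linarith [PiLp.norm_apply_le F s, PiLp.norm_apply_le F fun _ => false]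
    have h3 := hL (cellCenter v ε (m + cornerShift s)) c
    rw [hshift, norm_smul, Real.norm_of_nonneg hε.le] at h3
    refine (norm_sub_le _ _).trans ?_
    rw [norm_smul, Real.norm_of_nonneg hε.le]
    nlinarith
  rw [div_le_iff₀ hε, cornerOsc]
  refine (Finset.sum_le_sum fun s _ => hterm s).trans (le_of_eq ?_)
  rw [← Finset.mul_sum, Finset.sum_add_distrib, Finset.sum_const, Finset.card_univ,
    Fintype.card_fun, Fintype.card_bool, Fintype.card_fin, nsmul_eq_mul, Nat.cast_pow,
    Nat.cast_ofNat]
  ring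

lemma add_rpow_le_two_rpow_mul {a b p : ℝ} (ha : 0 ≤ a) (hb : 0 ≤ b) (hp : 0 ≤ p) :
    (a + b) ^ p ≤ 2 ^ p * (a ^ p + b ^ p) := by
  have h1 : a + b ≤ 2 * max a b := by linarith [le_max_left a b, le_max_right a b]
  calc (a + b) ^ p ≤ (2 * max a b) ^ p := Real.rpow_le_rpow (by positivity) h1 hp
    _ = 2 ^ p * max a b ^ p := Real.mul_rpow (by norm_num) (le_max_of_le_left ha)
    _ ≤ _ := by
      gcongr
      have h2 := Real.rpow_nonneg ha p
      have h3 := Real.rpow_nonneg hb p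
      rcases max_choice a b with h | h <;> rw [h] <;> linarith

/-- The energy controls the sum over all cells of the corner oscillations of `y - g`. -/
lemma exists_cornerOsc_bound {p : ℝ} (hp : 1 < p) (hΦ : ∀ t, Φ.symm t = applyA v t)
    {W : DiscreteGradient d → ℝ≥0}
    (hcoercive : ∃ c c' : ℝ, 0 < c ∧ 0 < c' ∧ ∀ F ∈ V0 d, c * ‖F‖ ^ p - c' ≤ (W F : ℝ))
    (hΩb : Bornology.IsBounded Ω) {L : ℝ} (hL0 : 0 ≤ L)
    (hL : ∀ x z, ‖g x - g z‖ ≤ L * ‖x - z‖) (C : ℝ≥0) :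
    ∃ G : ℝ≥0∞, G ≠ ⊤ ∧ ∀ ε : ℝ, 0 < ε → ∀ y ∈ latticeDeformationsBdry v ε Ω g,
      energy v W ε y Ω ≤ C →
      ENNReal.ofReal (ε ^ d) * ∑' m, ENNReal.ofReal
        ((cornerOsc (latticeDifference v ε Ω y g) m / ε) ^ p) ≤ G := by
  classical
  have hp0 : 0 < p := by linarith
  obtain ⟨c, c', hc, hc', hW⟩ := hcoercive
  set A : ℝ := 2 ^ d * 2 with hA
  set B : ℝ := ∑ s : Fin d → Bool, L * ‖applyA v (fun i => (cornerShift s i : ℝ))‖ with hB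
  have hA0 : 0 ≤ A := by positivity
  have hB0 : 0 ≤ B := Finset.sum_nonneg fun s _ => by positivity
  -- constants with `(A ‖F‖ + B) ^ p ≤ α W(F) + β` on `V_0`
  set α : ℝ := 2 ^ p * A ^ p / c with hα
  set β : ℝ := α * c' + 2 ^ p * B ^ p with hβ
  have hα0 : 0 ≤ α := by positivity
  have hβ0 : 0 ≤ β := by positivity
  have hF : ∀ F ∈ V0 d, (A * ‖F‖ + B) ^ p ≤ α * W F + β := by
    intro F hFV
    have h1 := add_rpow_le_two_rpow_mul (mul_nonneg hA0 (norm_nonneg F)) hB0 hp0.le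
    rw [Real.mul_rpow hA0 (norm_nonneg _)] at h1
    have h2 := mul_le_mul_of_nonneg_left (hW F hFV) hα0
    have h3 : α * (c * ‖F‖ ^ p - c') = 2 ^ p * (A ^ p * ‖F‖ ^ p) - α * c' := by
      rw [hα]
      field_simp
    rw [hβ]
    linarith
  refine ⟨ENNReal.ofReal α * C + ENNReal.ofReal β * ((cellVolume Φ)⁻¹ * volume Ω), ?_, ?_⟩
  · have h1 := cellVolume_ne_zero Φ
    have h2 : volume Ω ≠ ⊤ := hΩb.measure_lt_top.ne
    refine ENNReal.add_ne_top.2 ⟨by finiteness, ENNReal.mul_ne_top ENNReal.ofReal_ne_top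
      (ENNReal.mul_ne_top (by simpa using h1) h2)⟩
  intro ε hε y hy hC
  rw [energy, if_pos hy.1] at hC
  set I : Set (Fin d → ℤ) := {m | cellCenter v ε m ∈ innerCenters v ε Ω} with hI
  set w : (Fin d → ℤ) → ℝ≥0∞ := fun m => W (discreteGradient v ε y (cellCenter v ε m)) with hw
  have hosc : ∀ m, ENNReal.ofReal ((cornerOsc (latticeDifference v ε Ω y g) m / ε) ^ p) ≤
      ENNReal.ofReal α * I.indicator w m + ENNReal.ofReal β * I.indicator 1 m := by
    intro m
    by_cases hm : m ∈ I
    · rw [Set.indicator_of_mem hm, Set.indicator_of_mem hm, Pi.one_apply, mul_one, hw]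
      have h1 := cornerOsc_latticeDifference_le hΦ hε hy.1 hL hm
      have h2 := Real.rpow_le_rpow (div_nonneg (cornerOsc_nonneg _ _) hε.le) h1 hp0.le
      have h3 := h2.trans (hF _ (discreteGradient_mem_V0 v ε y _))
      refine (ENNReal.ofReal_le_ofReal h3).trans (le_of_eq ?_)
      rw [ENNReal.ofReal_add (by positivity) hβ0, ENNReal.ofReal_mul hα0,
        ENNReal.ofReal_coe_nnreal]
    · have h0 : cornerOsc (latticeDifference v ε Ω y g) m = 0 := by
        have h1 := latticeDifference_corner_eq_zero hΦ hε hy hm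
        have h2 := h1 fun _ => false
        have hzero : cornerShift (fun _ : Fin d => false) = 0 := by
          funext i
          simp [cornerShift]
        rw [hzero, add_zero] at h2
        exact Finset.sum_eq_zero fun s _ => by rw [h1 s, h2, sub_zero, norm_zero]
      rw [h0, zero_div, Real.zero_rpow hp0.ne', ENNReal.ofReal_zero]
      exact zero_le
  have hsum1 : ENNReal.ofReal (ε ^ d) * ∑' m, I.indicator w m ≤ C := by
    refine le_trans (mul_le_mul_right ?_ _) hC
    rw [← tsum_subtype]
    exact ENNReal.tsum_comp_le_tsum_of_injective
      (f := fun m : I => (⟨cellCenter v ε m, m.2⟩ : innerCenters v ε Ω))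
      (fun m n h => Subtype.ext (cellCenter_injective hΦ hε (congrArg Subtype.val h)))
      (fun c => (W (discreteGradient v ε y (c : Space d)) : ℝ≥0∞))
  have hsum2 : ENNReal.ofReal (ε ^ d) * ∑' m, I.indicator (1 : (Fin d → ℤ) → ℝ≥0∞) m ≤
      (cellVolume Φ)⁻¹ * volume Ω := by
    rw [← ENNReal.div_eq_inv_mul, ENNReal.le_div_iff_mul_le (Or.inl (cellVolume_ne_zero Φ))
      (Or.inl (cellVolume_ne_top Φ)), mul_comm, ← lintegral_comp_cellIndex Φ hε]
    -- the inner cells are disjoint subsets of `Ω`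
    refine le_trans (lintegral_mono (g := (toMeasurable volume Ω).indicator 1) fun x => ?_) ?_
    · by_cases hx : cellIndex Φ ε x ∈ I
      · have hxΩ : x ∈ Ω := hx.2 (subset_closure ((mem_cell_iff hΦ hε _ x).2 rfl))
        rw [Set.indicator_of_mem hx, Set.indicator_of_mem (subset_toMeasurable _ _ hxΩ)]
        simp
      · rw [Set.indicator_of_notMem hx]
        exact zero_le
    · rw [lintegral_indicator_one (measurableSet_toMeasurable _ _), measure_toMeasurable]
  calc _ ≤ ENNReal.ofReal (ε ^ d) * ∑' m, (ENNReal.ofReal α * I.indicator w m +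
          ENNReal.ofReal β * I.indicator 1 m) := by
        gcongr with m
        exact hosc m
    _ = ENNReal.ofReal α * (ENNReal.ofReal (ε ^ d) * ∑' m, I.indicator w m) +
          ENNReal.ofReal β * (ENNReal.ofReal (ε ^ d) * ∑' m, I.indicator 1 m) := by
        rw [ENNReal.tsum_add, ENNReal.tsum_mul_left, ENNReal.tsum_mul_left]
        ring
    _ ≤ _ := by gcongr

/-- A lattice deformation with bounded energy is, after subtracting `g` and up to an error of order
`ε` in `L^p(Ω)`, a test function with bounded gradient. -/
lemma exists_testFunction_approx {p : ℝ} (hp : 1 < p) (hΦ : ∀ t, Φ.symm t = applyA v t)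
    {W : DiscreteGradient d → ℝ≥0}
    (hcoercive : ∃ c c' : ℝ, 0 < c ∧ 0 < c' ∧ ∀ F ∈ V0 d, c * ‖F‖ ^ p - c' ≤ (W F : ℝ))
    (hΩo : IsOpen Ω) (hΩb : Bornology.IsBounded Ω) {L : ℝ} (hL0 : 0 ≤ L)
    (hL : ∀ x z, ‖g x - g z‖ ≤ L * ‖x - z‖) (C : ℝ≥0) :
    ∃ G : ℝ≥0∞, G ≠ ⊤ ∧ ∀ ε : ℝ, 0 < ε → ∀ y, energyBdry v W g ε y Ω ≤ C →
      ∃ ζ ∈ testFunctions Ω, ∫⁻ x, ‖fderiv ℝ ζ x‖ₑ ^ p ≤ G ∧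
        ∫⁻ x in Ω, ‖y x - g x - ζ x‖ₑ ^ p ≤ G * ENNReal.ofReal ε ^ p := by
  have hp0 : 0 < p := by linarith
  obtain ⟨G₀, hG₀, hosc⟩ := exists_cornerOsc_bound hp hΦ hcoercive hΩb hL0 hL C
  obtain ⟨Λ, hΛ, hinterp⟩ := exists_smooth_interpolation Φ
  obtain ⟨R, hR, hdiam⟩ := exists_norm_sub_le_of_cellIndex_eq Φ
  set κ := cellVolume Φ with hκ
  have hκtop : κ ≠ ⊤ := cellVolume_ne_top Φ
  have hvol : volume Ω ≠ ⊤ := hΩb.measure_lt_top.ne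
  set G₁ : ℝ≥0∞ := ENNReal.ofReal (Λ ^ p) * (κ * G₀) with hG₁
  set G₂ : ℝ≥0∞ := ENNReal.ofReal (2 ^ p) *
    (κ * G₀ + ENNReal.ofReal ((L * R) ^ p) * volume Ω) with hG₂
  refine ⟨G₁ + G₂, ?_, fun ε hε y hyC => ?_⟩
  · have h1 : κ * G₀ ≠ ⊤ := ENNReal.mul_ne_top hκtop hG₀
    exact ENNReal.add_ne_top.2 ⟨ENNReal.mul_ne_top ENNReal.ofReal_ne_top h1,
      ENNReal.mul_ne_top ENNReal.ofReal_ne_top (ENNReal.add_ne_top.2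
        ⟨h1, ENNReal.mul_ne_top ENNReal.ofReal_ne_top hvol⟩)⟩
  have hy : y ∈ latticeDeformationsBdry v ε Ω g := by
    by_contra h
    rw [energyBdry, if_neg h] at hyC
    exact ENNReal.coe_ne_top (top_le_iff.1 hyC)
  rw [energyBdry, if_pos hy] at hyC
  set Z := latticeDifference v ε Ω y g with hZ
  have hfin := finite_cellIndex_image Φ hε hΩb
  obtain ⟨ζ, hζs, hζZ, hζd, hζ0⟩ := hinterp ε hε Z
    (hfin.subset (latticeDifference_support_subset hΦ hε))
  set b : (Fin d → ℤ) → ℝ≥0∞ := fun m => ENNReal.ofReal ((cornerOsc Z m / ε) ^ p) with hb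
  have hbG : ∫⁻ x, b (cellIndex Φ ε x) ≤ κ * G₀ := by
    rw [lintegral_comp_cellIndex Φ hε]
    gcongr
    exact hosc ε hε y hy hyC
  have hosc0 : ∀ m, 0 ≤ cornerOsc Z m / ε := fun m => div_nonneg (cornerOsc_nonneg _ _) hε.le
  refine ⟨ζ, ⟨hζs, ?_⟩, ?_, ?_⟩
  · -- the support is covered by the finitely many closed inner cells
    set I : Set (Fin d → ℤ) := {m | cellCenter v ε m ∈ innerCenters v ε Ω} with hI
    have hIfin : I.Finite := hfin.subset fun m hm =>
      ⟨cellCenter v ε m, hm.2 (subset_closure ((mem_cell_iff hΦ hε _ _).2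
        (cellIndex_cellCenter hΦ hε m))), cellIndex_cellCenter hΦ hε m⟩
    have hsub : tsupport ζ ⊆ ⋃ m ∈ I, closure (cell v ε (cellCenter v ε m)) := by
      refine closure_minimal (fun x hx => ?_)
        (hIfin.isClosed_biUnion fun m _ => isClosed_closure)
      obtain ⟨s, hs⟩ := hζ0 x hx
      refine Set.mem_iUnion₂.2 ⟨cellIndex Φ ε x, ?_,
        subset_closure ((mem_cell_iff hΦ hε _ x).2 rfl)⟩
      by_contra hm
      exact hs (latticeDifference_corner_eq_zero hΦ hε hy hm s)
    have hsubΩ : tsupport ζ ⊆ Ω := hsub.trans (Set.iUnion₂_subset fun m hm => hm.2)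
    exact ⟨Metric.isCompact_of_isClosed_isBounded (isClosed_tsupport ζ) (hΩb.subset hsubΩ), hsubΩ⟩
  · calc ∫⁻ x, ‖fderiv ℝ ζ x‖ₑ ^ p
        ≤ ∫⁻ x, ENNReal.ofReal (Λ ^ p) * b (cellIndex Φ ε x) := by
          refine lintegral_mono fun x => ?_
          rw [← ofReal_norm, ENNReal.ofReal_rpow_of_nonneg (norm_nonneg _) hp0.le, hb,
            ← ENNReal.ofReal_mul (by positivity), ← Real.mul_rpow hΛ.le (hosc0 _)]
          exact ENNReal.ofReal_le_ofReal (Real.rpow_le_rpow (norm_nonneg _) (hζd x) hp0.le)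
      _ ≤ G₁ := by
          rw [lintegral_const_mul' _ _ ENNReal.ofReal_ne_top]
          exact mul_le_mul_right hbG _
      _ ≤ _ := le_self_add
  · have hpt : ∀ x ∈ Ω, ‖y x - g x - ζ x‖ₑ ^ p ≤ ENNReal.ofReal ε ^ p * (ENNReal.ofReal (2 ^ p) *
        (b (cellIndex Φ ε x) + ENNReal.ofReal ((L * R) ^ p))) := by
      intro x hx
      set m := cellIndex Φ ε x with hm
      have hZx : Z m = y x - g (cellCenter v ε m) :=
        latticeDifference_eq hy.1 ((mem_cell_iff hΦ hε _ x).2 rfl) hx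
      have h1 : ‖y x - g x - ζ x‖ ≤ ε * (cornerOsc Z m / ε + L * R) := by
        have h2 : y x - g x - ζ x = (g (cellCenter v ε m) - g x) - (ζ x - Z m) := by
          rw [hZx]
          abel
        have h3 := (hL (cellCenter v ε m) x).trans (mul_le_mul_of_nonneg_left
          (hdiam ε hε _ x ((cellIndex_cellCenter hΦ hε m).trans hm)) hL0)
        rw [h2, mul_add, mul_div_cancel₀ _ hε.ne']
        refine (norm_sub_le _ _).trans ?_
        linarith [hζZ x]
      have h4 := Real.rpow_le_rpow (norm_nonneg _) h1 hp0.le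
      have h5 := add_rpow_le_two_rpow_mul (hosc0 m) (by positivity : 0 ≤ L * R) hp0.le
      rw [Real.mul_rpow hε.le (add_nonneg (hosc0 m) (by positivity))] at h4
      have h6 : 0 ≤ ε ^ p := by positivity
      rw [← ofReal_norm, ENNReal.ofReal_rpow_of_nonneg (norm_nonneg _) hp0.le,
        ENNReal.ofReal_rpow_of_nonneg hε.le hp0.le, hb,
        ← ENNReal.ofReal_add (Real.rpow_nonneg (hosc0 m) p) (by positivity),
        ← ENNReal.ofReal_mul (by positivity), ← ENNReal.ofReal_mul h6]
      exact ENNReal.ofReal_le_ofReal (h4.trans (mul_le_mul_of_nonneg_left h5 h6))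
    calc _ ≤ ∫⁻ x in Ω, ENNReal.ofReal ε ^ p * (ENNReal.ofReal (2 ^ p) *
          (b (cellIndex Φ ε x) + ENNReal.ofReal ((L * R) ^ p))) :=
          setLIntegral_mono' hΩo.measurableSet hpt
      _ = ENNReal.ofReal ε ^ p * (ENNReal.ofReal (2 ^ p) *
          ((∫⁻ x in Ω, b (cellIndex Φ ε x)) + ENNReal.ofReal ((L * R) ^ p) * volume Ω)) := by
          rw [lintegral_const_mul' _ _ (by finiteness),
            lintegral_const_mul' _ _ ENNReal.ofReal_ne_top,
            lintegral_add_right _ measurable_const, setLIntegral_const]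
      _ ≤ ENNReal.ofReal ε ^ p * G₂ := by
          rw [hG₂]
          gcongr
          exact (setLIntegral_le_lintegral _ _).trans hbG
      _ ≤ _ := by
          rw [mul_comm]
          gcongr
          exact le_add_self

end Atomistic

open Atomistic
/-- Compactness of sequences with equibounded energies under boundary conditions. -/
theorem theorem1p4 {d : ℕ} (p : ℝ) (hp : 1 < p)
    -- the Bravais lattice `A ℤ^d`, `A = (v_1, …, v_d)`
    (v : Fin d → Space d) (hv : LinearIndependent ℝ v)
    -- the cell energy with `p`-growth from below and from above on `V_0`
    (W : DiscreteGradient d → ℝ≥0)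
    (hcoercive : ∃ c c' : ℝ, 0 < c ∧ 0 < c' ∧ ∀ F ∈ V0 d, c * ‖F‖ ^ p - c' ≤ (W F : ℝ))
    (hgrowth : ∃ c : ℝ, 0 < c ∧ ∀ F ∈ V0 d, (W F : ℝ) ≤ c * (‖F‖ ^ p + 1))
    -- the bounded open Lipschitz set
    (Ω : Set (Space d)) (hΩo : IsOpen Ω) (hΩb : Bornology.IsBounded Ω)
    (hΩL : HasLipschitzBoundary Ω)
    -- the boundary datum in `W^{1,∞}(ℝ^d; ℝ^d)`, continuous representative
    (g : Space d → Space d) (hg : MemW1p g ⊤ Set.univ) (hgc : Continuous g)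
    -- a sequence with equibounded energies
    (ε : ℕ → ℝ) (hε : ∀ n, 0 < ε n) (hε0 : Tendsto ε atTop (𝓝 0))
    (y : ℕ → Space d → Space d)
    (hy : ∀ n, MemLp (y n) (ENNReal.ofReal p) (volume.restrict Ω))
    (C : ℝ≥0) (hC : ∀ n, energyBdry v W g (ε n) (y n) Ω ≤ (C : ℝ≥0∞)) :
    ∃ (k : ℕ → ℕ) (u : Space d → Space d),
      StrictMono k ∧
      MemW1p u (ENNReal.ofReal p) Ω ∧
      MemW1pZero (u - g) (ENNReal.ofReal p) Ω ∧
      Tendsto (fun n => eLpNorm (y (k n) - u) (ENNReal.ofReal p) (volume.restrict Ω))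
        atTop (𝓝 0) := by
  have hp0 : 0 < p := by linarith
  have hq : (1 : ℝ≥0∞) ≤ ENNReal.ofReal p := by simpa using hp.le
  obtain ⟨Φ, hΦ⟩ := exists_latticeCoordinates hv
  obtain ⟨L, hL0, hL⟩ := hg.exists_lipschitz_const hgc
  obtain ⟨G, hG, happrox⟩ := exists_testFunction_approx hp hΦ hcoercive hΩo hΩb hL0 hL C
  choose ζ hζ hζG hζy using fun n => happrox (ε n) (hε n) (y n) (hC n)
  have hζ0 : ∀ n x, x ∉ Ω → ζ n x = 0 := fun n x hx =>
    image_eq_zero_of_notMem_tsupport fun h => hx ((hζ n).2.2 h)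
  obtain ⟨k, w, hk, hw, hkw⟩ := exists_subseq_tendsto_eLpNorm hp Φ hΩb ζ
    (fun n => (hζ n).1.of_le (by simp)) hζ0 hG hζG
  have hkwΩ : Tendsto (fun n => eLpNorm (ζ (k n) - w) (ENNReal.ofReal p) (volume.restrict Ω))
      atTop (𝓝 0) :=
    tendsto_of_tendsto_of_tendsto_of_le_of_le tendsto_const_nhds hkw (fun _ => zero_le)
      fun n => eLpNorm_mono_measure _ Measure.restrict_le_self
  have hw0 : MemW1pZero w (ENNReal.ofReal p) Ω :=
    memW1pZero_of_tendsto hp hΩb (fun n => hζ (k n)) (hw.restrict Ω) hkwΩ hG fun n => hζG (k n)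
  have hgΩ := hg.mono_exponent_of_isBounded hΩb (ENNReal.ofReal p)
  have hu : w + g - g = w := add_sub_cancel_right w g
  refine ⟨k, w + g, hk, hw0.memW1p.add hΩb hq hgΩ, hu.symm ▸ hw0, ?_⟩
  have hr : Tendsto (fun n => G ^ p⁻¹ * ENNReal.ofReal (ε (k n))) atTop (𝓝 0) := by
    have h1 := ENNReal.tendsto_ofReal (hε0.comp hk.tendsto_atTop)
    rw [ENNReal.ofReal_zero] at h1
    have h2 := ENNReal.Tendsto.const_mul h1
      (Or.inr (ENNReal.rpow_ne_top_of_nonneg (inv_nonneg.2 hp0.le) hG))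
    rwa [mul_zero] at h2
  have hlim := hr.add hkwΩ
  rw [add_zero] at hlim
  refine tendsto_of_tendsto_of_tendsto_of_le_of_le tendsto_const_nhds hlim (fun _ => zero_le)
    fun n => ?_
  have hζm : AEStronglyMeasurable (ζ (k n)) (volume.restrict Ω) :=
    (hζ (k n)).1.continuous.aestronglyMeasurable
  have hsplit : y (k n) - (w + g) = (y (k n) - g - ζ (k n)) + (ζ (k n) - w) := by abel
  rw [hsplit]
  refine (eLpNorm_add_le (((hy _).1.sub hgΩ.1.1).sub hζm) (hζm.sub (hw.restrict Ω).1) hq).trans ?_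
  gcongr
  refine eLpNorm_le_of_lintegral_le hp ?_
  rw [ENNReal.mul_rpow_of_nonneg _ _ hp0.le, ENNReal.rpow_inv_rpow hp0.ne']
  exact hζy (k n)
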